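/- Let $N$ be a simply connected (finite-dimensional, real) Lie group whose Lie algebra $\mathfrak n$ is 2-step nilpotent, i.e. $[\mathfrak n,[\mathfrak n,\mathfrak n]]=0$ and $[\mathfrak n,\mathfrak n]\neq 0$, and let $Q$ be a bi-invariant pseudo-Riemannian metric on $N$ (a smooth field of nondegenerate symmetric bilinear forms on the tangent spaces, of arbitrary signature, invariant under all left and all right translations). Then $(N,Q)$ has a Levi-Civita connection $\nabla$, and it is flat: the curvature $R(X,Y)Z=\nabla_X\nabla_YZ-\nabla_Y\nabla_XZ-\nabla_{[X,Y]}Z$ vanishes for all smooth vector fields $X,Y,Z$ on $N$. Moreover its holonomy is trivial: for every $p\in N$, the parallel transport around every piecewise $C^1$ loop based at $p$ exists and is the identity of $T_pN$, so the holonomy group at $p$ is trivial. -/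

import Mathlib

open Set Bundle VectorField
open scoped Manifold ContDiff Topology

noncomputable section

/-- Over the reals the threshold used by Mathlib for Lie groups is the finite order `3`, so that a
smooth Lie group has a Lie algebra. -/
instance instLEInftyMinSmoothnessReal : ENat.LEInfty (minSmoothness ℝ 3) :=
  ⟨by simpa using (ENat.LEInfty.out : (3 : ℕ∞ω) ≤ ∞)⟩

/-- A Lie algebra `L` is 2-step nilpotent if `C²(L) = 0` and `C¹(L) ≠ 0`, where `C⁰(L) = L` and
`Cʳ⁺¹(L) = [L, Cʳ(L)]`. -/
def IsTwoStepNilpotent (L : Type*) [LieRing L] [LieAlgebra ℝ L] : Prop :=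
  LieModule.lowerCentralSeries ℝ L L 2 = ⊥ ∧ LieModule.lowerCentralSeries ℝ L L 1 ≠ ⊥

section Manifold

variable {E : Type*} [NormedAddCommGroup E] [NormedSpace ℝ E]
  {H : Type*} [TopologicalSpace H] (I : ModelWithCorners ℝ E H)
  (M : Type*) [TopologicalSpace M] [ChartedSpace H M]

/-- A smooth pseudo-Riemannian metric on `M`: a smooth field of nondegenerate symmetric bilinear
forms, of any signature, on the tangent spaces. -/
structure PseudoRiemannianMetric [IsManifold I ∞ M] where
  /-- The bilinear form on the tangent space at `x`. -/
  inner (x : M) : TangentSpace I x →L[ℝ] TangentSpace I x →L[ℝ] ℝ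
  symm (x : M) (v w : TangentSpace I x) : inner x v w = inner x w v
  nondegenerate (x : M) (v : TangentSpace I x) (hv : ∀ w, inner x v w = 0) : v = 0
  contMDiff : ContMDiff I (I.prod 𝓘(ℝ, E →L[ℝ] E →L[ℝ] ℝ)) ∞
    (fun x ↦ TotalSpace.mk' (E →L[ℝ] E →L[ℝ] ℝ) x (inner x))

variable {I M}

/-- The metric is invariant under all left translations and all right translations. -/
def PseudoRiemannianMetric.IsBiInvariant [IsManifold I ∞ M] [Group M]
    (Q : PseudoRiemannianMetric I M) : Prop :=
  (∀ (g x : M) (v w : TangentSpace I x),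
    Q.inner (g * x) (mfderiv I I (fun y ↦ g * y) x v) (mfderiv I I (fun y ↦ g * y) x w)
      = Q.inner x v w) ∧
  (∀ (g x : M) (v w : TangentSpace I x),
    Q.inner (x * g) (mfderiv I I (fun y ↦ y * g) x v) (mfderiv I I (fun y ↦ y * g) x w)
      = Q.inner x v w)

/-- `∇` is the Levi-Civita connection of `Q`: it is smooth, torsion-free and compatible with `Q`.
Here `∇ Y x v` is the covariant derivative of the vector field `Y` in the direction `v` at `x`. -/
structure IsLeviCivita [FiniteDimensional ℝ E] [CompleteSpace E] [IsManifold I ∞ M]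
    (Q : PseudoRiemannianMetric I M)
    (cov : CovariantDerivative I E (TangentSpace I : M → Type _)) : Prop where
  smooth : CovariantDerivative.ContMDiffCovariantDerivative cov ∞
  torsion_eq_zero : cov.torsion = 0
  compatible : ∀ (Y Z : Π x : M, TangentSpace I x) (x : M), MDiffAt (T% Y) x → MDiffAt (T% Z) x →
    ∀ v : TangentSpace I x,
      mvfderiv I (fun y ↦ Q.inner y (Y y) (Z y)) x v
        = Q.inner x (cov Y x v) (Z x) + Q.inner x (Y x) (cov Z x v)

/-- The curvature `R(X, Y) Z = ∇_X ∇_Y Z - ∇_Y ∇_X Z - ∇_{[X, Y]} Z`. -/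
def curvature [IsManifold I 1 M]
    (cov : CovariantDerivative I E (TangentSpace I : M → Type _))
    (X Y Z : Π x : M, TangentSpace I x) (x : M) : TangentSpace I x :=
  cov (fun y ↦ cov Z y (Y y)) x (X x) - cov (fun y ↦ cov Z y (X y)) x (Y x)
    - cov Z x (mlieBracket I X Y x)

/-- The curvature tensor vanishes identically. -/
def IsFlat [IsManifold I ∞ M]
    (cov : CovariantDerivative I E (TangentSpace I : M → Type _)) : Prop :=
  ∀ X Y Z : Π x : M, TangentSpace I x, CMDiff ∞ (T% X) → CMDiff ∞ (T% Y) → CMDiff ∞ (T% Z) →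
    ∀ x, curvature cov X Y Z x = 0

/-- The restriction of `γ` to `[0, 1]` is piecewise `C¹`: it is continuous, and it is `C¹` on every
closed subinterval that has none of finitely many break points in its interior. -/
def IsPiecewiseC1 (I : ModelWithCorners ℝ E H) (γ : ℝ → M) : Prop :=
  ContinuousOn γ (Icc 0 1) ∧ ∃ S : Finset ℝ, ∀ a ∈ Icc (0 : ℝ) 1, ∀ b ∈ Icc (0 : ℝ) 1, a < b →
    (∀ s ∈ S, s ∉ Ioo a b) → ContMDiffOn 𝓘(ℝ, ℝ) I 1 γ (Icc a b)

/-- The covariant derivative `D V / dt` at time `t` of a vector field `V` along the curve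
`γ s = (V s).proj` (the pair is given as one curve in the tangent bundle). In the trivialization of
the tangent bundle centred at `γ t`, with local frame `eᵢ`, write `V s = ∑ vᵢ(s) eᵢ(γ s)`; then
`D V / dt = ∑ vᵢ'(t) eᵢ + ∇_{γ'(t)} (∑ vᵢ(t) eᵢ)`: the first summand below is the derivative of the
coordinates, and `FiberBundle.extend` extends `V t` to the field `∑ vᵢ(t) eᵢ`. -/
def covDerivAlong [IsManifold I 1 M]
    (cov : CovariantDerivative I E (TangentSpace I : M → Type _))
    (V : ℝ → TangentBundle I M) (t : ℝ) : TangentSpace I (V t).proj :=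
  (trivializationAt E (TangentSpace I) (V t).proj).symm (V t).proj
      (deriv (fun s ↦ (trivializationAt E (TangentSpace I) (V t).proj (V s)).2) t)
    + cov (FiberBundle.extend E (V t).snd) (V t).proj
        (mfderiv 𝓘(ℝ, ℝ) I (fun s ↦ (V s).proj) t (1 : ℝ))

/-- `V` is a parallel field over `[0, 1]` along its base curve: it is continuous, and `D V / dt = 0`
except at finitely many times. -/
def IsParallel [IsManifold I 1 M]
    (cov : CovariantDerivative I E (TangentSpace I : M → Type _))
    (V : ℝ → TangentBundle I M) : Prop :=
  ContinuousOn V (Icc 0 1) ∧ ∃ S : Finset ℝ, ∀ t ∈ Ioo (0 : ℝ) 1, t ∉ S →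
    MDifferentiableAt 𝓘(ℝ, ℝ) I.tangent V t ∧ covDerivAlong cov V t = 0

/-- `A` is the parallel transport once around the loop `γ`, `0 ≤ t ≤ 1`, based at `p`: each `v` is
the initial value of a parallel field along `γ` with final value `A v`. -/
def IsParallelTransport [IsManifold I 1 M]
    (cov : CovariantDerivative I E (TangentSpace I : M → Type _)) (p : M) (γ : ℝ → M)
    (A : TangentSpace I p ≃ₗ[ℝ] TangentSpace I p) : Prop :=
  ∀ v : TangentSpace I p, ∃ V : ℝ → TangentBundle I M,
    (∀ t ∈ Icc (0 : ℝ) 1, (V t).proj = γ t) ∧ IsParallel cov V ∧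
      V 0 = ⟨p, v⟩ ∧ V 1 = ⟨p, A v⟩

/-- The holonomy group at `p`: the group of linear automorphisms of `T_p M` generated by (in fact,
consisting of) the parallel transports around piecewise `C¹` loops based at `p`. -/
def holonomyGroup [IsManifold I 1 M]
    (cov : CovariantDerivative I E (TangentSpace I : M → Type _)) (p : M) :
    Subgroup (TangentSpace I p ≃ₗ[ℝ] TangentSpace I p) :=
  Subgroup.closure {A | ∃ γ : ℝ → M, IsPiecewiseC1 I γ ∧ γ 0 = p ∧ γ 1 = p ∧
    IsParallelTransport cov p γ A}

end Manifold

end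

noncomputable section

section MVFDeriv

variable {E : Type*} [NormedAddCommGroup E] [NormedSpace ℝ E]
  {H : Type*} [TopologicalSpace H] {I : ModelWithCorners ℝ E H}
  {M : Type*} [TopologicalSpace M] [ChartedSpace H M]
  {F : Type*} [NormedAddCommGroup F] [NormedSpace ℝ F]
  {G : Type*} [NormedAddCommGroup G] [NormedSpace ℝ G]

lemma HasMFDerivAt.mvfderiv_eq {f : M → F} {x : M} {f' : TangentSpace I x →L[ℝ] F}
    (h : HasMFDerivAt I 𝓘(ℝ, F) f x f') : mvfderiv I f x = f' :=
  h.mfderiv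

lemma MDifferentiableAt.hasMFDerivAt_mvfderiv {f : M → F} {x : M}
    (h : MDifferentiableAt I 𝓘(ℝ, F) f x) :
    HasMFDerivAt I 𝓘(ℝ, F) f x (mvfderiv I f x) :=
  h.hasMFDerivAt

lemma HasMFDerivAt.continuousLinearMap_comp {f : M → F} {x : M} {f' : TangentSpace I x →L[ℝ] F}
    (L : F →L[ℝ] G) (h : HasMFDerivAt I 𝓘(ℝ, F) f x f') :
    HasMFDerivAt I 𝓘(ℝ, G) (fun y ↦ L (f y)) x (L ∘L f') :=
  HasMFDerivAt.comp x (L.hasMFDerivAt (x := f x)) h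

lemma mvfderiv_clm_comp {f : M → F} {x : M} (L : F →L[ℝ] G)
    (h : MDifferentiableAt I 𝓘(ℝ, F) f x) :
    mvfderiv I (fun y ↦ L (f y)) x = L ∘L mvfderiv I f x :=
  (h.hasMFDerivAt_mvfderiv.continuousLinearMap_comp L).mvfderiv_eq

lemma MDifferentiableAt.continuousLinearMap_comp {f : M → F} {x : M} (L : F →L[ℝ] G)
    (h : MDifferentiableAt I 𝓘(ℝ, F) f x) :
    MDifferentiableAt I 𝓘(ℝ, G) (fun y ↦ L (f y)) x :=
  (h.hasMFDerivAt_mvfderiv.continuousLinearMap_comp L).mdifferentiableAt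

lemma ContMDiffAt.continuousLinearMap_comp {n : ℕ∞ω} {f : M → F} {x : M} (L : F →L[ℝ] G)
    (h : ContMDiffAt I 𝓘(ℝ, F) n f x) : ContMDiffAt I 𝓘(ℝ, G) n (fun y ↦ L (f y)) x :=
  L.contMDiff.contMDiffAt.comp x h

variable [IsManifold I ∞ M]

lemma ContMDiffAt.mvfderiv_apply {f : M → F} {X : Π x : M, TangentSpace I x} {x : M}
    (hf : CMDiff ∞ f) (hX : CMDiffAt ∞ (T% X) x) :
    CMDiffAt ∞ (fun y ↦ mvfderiv I f y (X y)) x := by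
  have h1 : ContMDiff I.tangent 𝓘(ℝ, F).tangent ∞ (tangentMap I 𝓘(ℝ, F) f) :=
    hf.contMDiff_tangentMap (m := ∞) le_rfl
  exact ((contMDiff_snd_tangentBundle_modelSpace F 𝓘(ℝ, F)).comp h1).contMDiffAt.comp x hX

lemma ContMDiff.mvfderiv_apply {f : M → F} {X : Π x : M, TangentSpace I x}
    (hf : CMDiff ∞ f) (hX : CMDiff ∞ (T% X)) :
    CMDiff ∞ (fun y ↦ mvfderiv I f y (X y)) :=
  fun x ↦ ContMDiffAt.mvfderiv_apply hf (hX x)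

end MVFDeriv

section Parallelization

variable {E : Type*} [NormedAddCommGroup E] [NormedSpace ℝ E]
  {H : Type*} [TopologicalSpace H] (I : ModelWithCorners ℝ E H)
  (M : Type*) [TopologicalSpace M] [ChartedSpace H M]

/-- A smooth trivialization of the tangent bundle of `M`. -/
structure Parallelization [IsManifold I ∞ M] where
  /-- The identification of the tangent space at `x` with the model space. -/
  coord (x : M) : TangentSpace I x ≃L[ℝ] E
  contMDiff_coord : ContMDiff I.tangent 𝓘(ℝ, E) ∞ (fun W : TangentBundle I M ↦ coord W.proj W.snd)
  contMDiff_symm (a : E) : CMDiff ∞ (T% (fun x : M ↦ (coord x).symm a))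

variable {I M} [IsManifold I ∞ M]

namespace Parallelization

variable (θ : Parallelization I M)

/-- The vector field with constant coordinates `a`. -/
def field (a : E) (x : M) : TangentSpace I x := (θ.coord x).symm a

lemma coord_field (a : E) (x : M) : θ.coord x (θ.field a x) = a :=
  (θ.coord x).apply_symm_apply a

lemma field_coord {x : M} (v : TangentSpace I x) : θ.field (θ.coord x v) x = v :=
  (θ.coord x).symm_apply_apply v

lemma contMDiff_field (a : E) : CMDiff ∞ (T% (θ.field a)) := θ.contMDiff_symm a

lemma mdifferentiableAt_field (a : E) (x : M) : MDiffAt (T% (θ.field a)) x :=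
  (θ.contMDiff_field a).mdifferentiable (by simp) x

variable {θ}

lemma contMDiff_coord_comp {σ : Π x : M, TangentSpace I x} (hσ : CMDiff ∞ (T% σ)) :
    CMDiff ∞ (fun y ↦ θ.coord y (σ y)) :=
  θ.contMDiff_coord.comp hσ

lemma mdifferentiableAt_coord_comp {σ : Π x : M, TangentSpace I x} {x : M}
    (hσ : MDiffAt (T% σ) x) : MDiffAt (fun y ↦ θ.coord y (σ y)) x :=
  MDifferentiableAt.comp (I' := I.tangent) x
    (θ.contMDiff_coord.mdifferentiable (by simp) (⟨x, σ x⟩ : TangentBundle I M)) hσ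

variable (θ) [FiniteDimensional ℝ E]

lemma symm_eq_sum (x : M) (a : E) : (θ.coord x).symm a =
    ∑ i, (Module.finBasis ℝ E).equivFunL a i • θ.field (Module.finBasis ℝ E i) x := by
  have h := congrArg (θ.coord x).symm ((Module.finBasis ℝ E).sum_repr a)
  rw [map_sum] at h
  simp only [map_smul] at h
  exact h.symm

/-- The coordinates of a vector in the standard basis. -/
def stdCoord (E : Type*) [NormedAddCommGroup E] [NormedSpace ℝ E] [FiniteDimensional ℝ E]
    (i : Fin (Module.finrank ℝ E)) : E →L[ℝ] ℝ :=
  (ContinuousLinearMap.proj (R := ℝ) i) ∘L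
    ((Module.finBasis ℝ E).equivFunL : E →L[ℝ] (Fin (Module.finrank ℝ E) → ℝ))

lemma symm_comp_eq_sum (f : M → E) : (fun x ↦ (θ.coord x).symm (f x)) =
    ∑ i, (fun x ↦ stdCoord E i (f x)) • θ.field (Module.finBasis ℝ E i) := by
  ext x
  rw [θ.symm_eq_sum, Finset.sum_apply]
  rfl

variable {θ}

lemma contMDiffAt_symm_comp {n : ℕ∞ω} (hn : n ≤ ∞) {f : M → E} {x : M} (hf : CMDiffAt n f x) :
    CMDiffAt n (T% (fun y ↦ (θ.coord y).symm (f y))) x := by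
  have : CMDiffAt n (T% (fun y ↦ ∑ i, ((fun x ↦ stdCoord E i (f x)) •
      θ.field (Module.finBasis ℝ E i)) y)) x :=
    ContMDiffAt.sum_section fun i _ ↦
      (ContMDiffAt.continuousLinearMap_comp (stdCoord E i) hf).smul_section
        ((θ.contMDiff_field _).contMDiffAt.of_le hn)
  convert! this with y
  rw [congrFun (θ.symm_comp_eq_sum f) y, Finset.sum_apply]

end Parallelization

lemma CovariantDerivative.sum {ι : Type*} (s : Finset ι)
    (cov : CovariantDerivative I E (TangentSpace I : M → Type _))
    {σ : ι → Π x : M, TangentSpace I x} {x : M} (hσ : ∀ i ∈ s, MDiffAt (T% (σ i)) x) :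
    cov (∑ i ∈ s, σ i) x = ∑ i ∈ s, cov (σ i) x := by
  classical
  induction s using Finset.induction_on with
  | empty => simp
  | insert i s his ih =>
    rw [Finset.sum_insert his, Finset.sum_insert his, ← ih fun j hj ↦ hσ j (by simp [hj])]
    refine cov.isCovariantDerivativeOnUniv.add (hσ i (by simp)) ?_
    have := MDifferentiableAt.sum_section (s := s) (t := σ) (x₀ := x)
      fun j hj ↦ hσ j (by simp [hj])
    convert! this with y
    simp

namespace Parallelization

variable {θ : Parallelization I M} [FiniteDimensional ℝ E]
  (cov : CovariantDerivative I E (TangentSpace I : M → Type _))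

lemma cov_symm_comp_eq_sum {f : M → E} {x : M} (hf : MDiffAt f x) (v : TangentSpace I x) :
    cov (fun y ↦ (θ.coord y).symm (f y)) x v = (θ.coord x).symm (mvfderiv I f x v) +
      ∑ i, stdCoord E i (f x) • cov (θ.field (Module.finBasis ℝ E i)) x v := by
  have h1 (i) : MDiffAt (fun x ↦ stdCoord E i (f x)) x := hf.continuousLinearMap_comp (stdCoord E i)
  rw [symm_comp_eq_sum, CovariantDerivative.sum Finset.univ cov fun i _ ↦
    (h1 i).smul_section (θ.mdifferentiableAt_field _ x), symm_eq_sum, sum_apply,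
    ← Finset.sum_add_distrib]
  refine Finset.sum_congr rfl fun i _ ↦ ?_
  rw [cov.isCovariantDerivativeOnUniv.leibniz (θ.mdifferentiableAt_field _ x) (h1 i),
    mvfderiv_clm_comp _ hf, add_comm]
  rfl

/-- The covariant derivative of a vector field given by its coordinates. -/
lemma cov_symm_comp {f : M → E} {x : M} (hf : MDiffAt f x) (v : TangentSpace I x) :
    cov (fun y ↦ (θ.coord y).symm (f y)) x v =
      (θ.coord x).symm (mvfderiv I f x v) + cov (θ.field (f x)) x v := by
  have h : cov (θ.field (f x)) x v =
      ∑ i, stdCoord E i (f x) • cov (θ.field (Module.finBasis ℝ E i)) x v := by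
    have := cov_symm_comp_eq_sum (θ := θ) cov (f := fun _ : M ↦ f x) (x := x)
      mdifferentiableAt_const v
    rw [mvfderiv_const] at this
    simpa using! this
  rw [cov_symm_comp_eq_sum cov hf, h]

lemma cov_eq {σ : Π x : M, TangentSpace I x} {x : M} (hσ : MDiffAt (T% σ) x)
    (v : TangentSpace I x) :
    cov σ x v = (θ.coord x).symm (mvfderiv I (fun y ↦ θ.coord y (σ y)) x v) +
      cov (θ.field (θ.coord x (σ x))) x v := by
  rw [← cov_symm_comp cov (mdifferentiableAt_coord_comp hσ)]
  simp

end Parallelization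

end Parallelization

section LieBracketDeriv

variable {E : Type*} [NormedAddCommGroup E] [NormedSpace ℝ E] [FiniteDimensional ℝ E]
  [CompleteSpace E]
  {H : Type*} [TopologicalSpace H] {I : ModelWithCorners ℝ E H}
  {M : Type*} [TopologicalSpace M] [ChartedSpace H M] [IsManifold I ∞ M]

omit [FiniteDimensional ℝ E] in
lemma ContMDiff.mdifferentiable_mlieBracket {X Y : Π x : M, TangentSpace I x}
    (hX : CMDiff ∞ (T% X)) (hY : CMDiff ∞ (T% Y)) :
    MDiff (T% (mlieBracket I X Y)) := by
  intro x
  have h2 : ((2 : ℕ∞) : ℕ∞ω) + 1 ≤ ∞ := by exact_mod_cast (le_top : (2 : ℕ∞) + 1 ≤ ⊤)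
  have : IsManifold I (((2 : ℕ∞) : ℕ∞ω) + 1) M := IsManifold.of_le (n := ∞) h2
  have hle := le_self_add.trans h2
  have h := ContMDiffAt.mlieBracket_vectorField (m := 1) (n := 2) (I := I) (x := x) (U := X) (V := Y)
    (hX.contMDiffAt.of_le hle) (hY.contMDiffAt.of_le hle)
    (by rw [minSmoothness_of_isRCLikeNormedField]; norm_num)
  exact h.mdifferentiableAt (by simp)

omit [FiniteDimensional ℝ E] in
/-- If a smooth vector field `W` does not vanish at `x`, the Jacobi identity for `X`, `Y` and
`f • W` shows that `[X, Y]` acts on `f` as a commutator. -/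
lemma mvfderiv_mlieBracket_smul {f : M → ℝ} (hf : CMDiff ∞ f) {X Y W : Π x : M, TangentSpace I x}
    (hX : CMDiff ∞ (T% X)) (hY : CMDiff ∞ (T% Y)) (hW : CMDiff ∞ (T% W)) (x : M) :
    (mvfderiv I (fun y ↦ mvfderiv I f y (Y y)) x (X x)
      - mvfderiv I (fun y ↦ mvfderiv I f y (X y)) x (Y x)
      - mvfderiv I f x (mlieBracket I X Y x)) • W x = 0 := by
  have : IsManifold I (minSmoothness ℝ 3) M := IsManifold.of_le (n := ∞) ENat.LEInfty.out
  have hdf {g : M → ℝ} (hg : CMDiff ∞ g) (y : M) : MDiffAt g y := hg.mdifferentiable (by simp) y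
  have hdW : MDiff (T% W) := hW.mdifferentiable (by simp)
  have hYf := ContMDiff.mvfderiv_apply hf hY
  have hXf := ContMDiff.mvfderiv_apply hf hX
  have expand {X Y : Π x : M, TangentSpace I x} (hX : CMDiff ∞ (T% X)) (hY : CMDiff ∞ (T% Y)) :
      mlieBracket I X (mlieBracket I Y (f • W)) x =
        mvfderiv I (fun y ↦ mvfderiv I f y (Y y)) x (X x) • W x
        + mvfderiv I f x (Y x) • mlieBracket I X W x
        + (mvfderiv I f x (X x) • mlieBracket I Y W x
        + f x • mlieBracket I X (mlieBracket I Y W) x) := by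
    have hYf := ContMDiff.mvfderiv_apply hf hY
    have h1 : mlieBracket I Y (f • W) =
        (fun y ↦ mvfderiv I f y (Y y)) • W + f • mlieBracket I Y W := by
      ext y
      exact mlieBracket_smul_right (hdf hf y) (hdW y)
    rw [h1, mlieBracket_add_right ((hdf hYf x).smul_section (hdW x))
      ((hdf hf x).smul_section (hY.mdifferentiable_mlieBracket hW x)),
      mlieBracket_smul_right (hdf hYf x) (hdW x),
      mlieBracket_smul_right (hdf hf x) (hY.mdifferentiable_mlieBracket hW x)]
  have hle : minSmoothness ℝ 2 ≤ (∞ : ℕ∞ω) := by simp; exact ENat.LEInfty.out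
  have J1 := leibniz_identity_mlieBracket_apply (I := I) (x := x) (U := X) (V := Y) (W := f • W)
    (hX.contMDiffAt.of_le hle) (hY.contMDiffAt.of_le hle)
    ((hf.smul_section hW).contMDiffAt.of_le hle)
  have J2 := leibniz_identity_mlieBracket_apply (I := I) (x := x) (U := X) (V := Y) (W := W)
    (hX.contMDiffAt.of_le hle) (hY.contMDiffAt.of_le hle) (hW.contMDiffAt.of_le hle)
  rw [expand hX hY, expand hY hX, mlieBracket_smul_right (hdf hf x) (hdW x), J2] at J1
  rw [← sub_eq_zero] at J1
  refine Eq.trans ?_ J1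
  module

end LieBracketDeriv

lemma HasMFDerivAt.comp_curve {E : Type*} [NormedAddCommGroup E] [NormedSpace ℝ E]
    {H : Type*} [TopologicalSpace H] {I : ModelWithCorners ℝ E H}
    {M : Type*} [TopologicalSpace M] [ChartedSpace H M]
    {F : Type*} [NormedAddCommGroup F] [NormedSpace ℝ F] {f : M → F} {γ : ℝ → M} {t : ℝ}
    {f' : TangentSpace I (γ t) →L[ℝ] F}
    (hf : HasMFDerivAt I 𝓘(ℝ, F) f (γ t) f') (hγ : MDifferentiableAt 𝓘(ℝ, ℝ) I γ t) :
    HasDerivAt (fun s ↦ f (γ s)) (f' (mfderiv 𝓘(ℝ, ℝ) I γ t (1 : ℝ))) t := by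
  have h : HasFDerivAt (f ∘ γ) (f' ∘L mfderiv 𝓘(ℝ, ℝ) I γ t : ℝ →L[ℝ] F) t :=
    (HasMFDerivAt.comp t hf hγ.hasMFDerivAt).hasFDerivAt
  exact h.hasDerivAt

namespace Parallelization

variable {E : Type*} [NormedAddCommGroup E] [NormedSpace ℝ E] [FiniteDimensional ℝ E]
  [CompleteSpace E]
  {H : Type*} [TopologicalSpace H] {I : ModelWithCorners ℝ E H}
  {M : Type*} [TopologicalSpace M] [ChartedSpace H M] [IsManifold I ∞ M]
  (θ : Parallelization I M)

include θ in
/-- The Lie bracket of vector fields acts on functions as a commutator. -/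
lemma mvfderiv_mlieBracket {f : M → E} (hf : CMDiff ∞ f)
    {X Y : Π x : M, TangentSpace I x} (hX : CMDiff ∞ (T% X)) (hY : CMDiff ∞ (T% Y)) (x : M) :
    mvfderiv I f x (mlieBracket I X Y x) =
      mvfderiv I (fun y ↦ mvfderiv I f y (Y y)) x (X x)
      - mvfderiv I (fun y ↦ mvfderiv I f y (X y)) x (Y x) := by
  rcases subsingleton_or_nontrivial E with hE | hE
  · exact Subsingleton.elim _ _
  obtain ⟨a, ha⟩ := exists_ne (0 : E)
  have hW : θ.field a x ≠ 0 := fun h ↦ ha (by rw [← θ.coord_field a x, h, map_zero])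
  refine (Module.finBasis ℝ E).ext_elem fun i ↦ ?_
  change stdCoord E i _ = stdCoord E i _
  have hfi : CMDiff ∞ (fun y ↦ stdCoord E i (f y)) := fun y ↦ (hf y).continuousLinearMap_comp _
  have hd (y : M) : MDiffAt f y := hf.mdifferentiable (by simp) y
  have hY' := (ContMDiff.mvfderiv_apply hf hY).mdifferentiable (by simp) x
  have hX' := (ContMDiff.mvfderiv_apply hf hX).mdifferentiable (by simp) x
  have key := (smul_eq_zero.1 (mvfderiv_mlieBracket_smul hfi hX hY (θ.contMDiff_field a) x)).resolve_right hW
  have e (Z : Π x : M, TangentSpace I x) :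
      (fun y ↦ mvfderiv I (fun y ↦ stdCoord E i (f y)) y (Z y)) =
        fun y ↦ stdCoord E i (mvfderiv I f y (Z y)) := by
    ext y
    rw [mvfderiv_clm_comp _ (hd y)]; rfl
  rw [e X, e Y, mvfderiv_clm_comp _ hX', mvfderiv_clm_comp _ hY', mvfderiv_clm_comp _ (hd x),
    sub_eq_zero] at key
  rw [map_sub]
  exact key.symm

/-- The fields with constant coordinates are parallel. -/
def IsParallelFor (cov : CovariantDerivative I E (TangentSpace I : M → Type _)) : Prop :=
  ∀ a x, cov (θ.field a) x = 0

variable {θ} {cov : CovariantDerivative I E (TangentSpace I : M → Type _)}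

omit [CompleteSpace E] in
lemma IsParallelFor.cov_eq (h : θ.IsParallelFor cov) {σ : Π x : M, TangentSpace I x} {x : M}
    (hσ : MDiffAt (T% σ) x) (v : TangentSpace I x) :
    cov σ x v = (θ.coord x).symm (mvfderiv I (fun y ↦ θ.coord y (σ y)) x v) := by
  rw [Parallelization.cov_eq (θ := θ) cov hσ, h]
  simp

/-- A connection with a parallel frame is flat. -/
lemma IsParallelFor.isFlat (h : θ.IsParallelFor cov) : IsFlat cov := by
  intro X Y Z hX hY hZ x
  have hz := contMDiff_coord_comp (θ := θ) hZ
  have key {X Y : Π x : M, TangentSpace I x} (hY : CMDiff ∞ (T% Y)) :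
      cov (fun y ↦ cov Z y (Y y)) x (X x) = (θ.coord x).symm
        (mvfderiv I (fun y ↦ mvfderiv I (fun y ↦ θ.coord y (Z y)) y (Y y)) x (X x)) := by
    have e : (fun y ↦ cov Z y (Y y)) =
        fun y ↦ (θ.coord y).symm (mvfderiv I (fun y ↦ θ.coord y (Z y)) y (Y y)) := by
      ext y
      exact h.cov_eq (hZ.mdifferentiable (by simp) y) _
    rw [e, cov_symm_comp cov ((ContMDiff.mvfderiv_apply hz hY).mdifferentiable (by simp) x), h]
    simp
  rw [curvature, key hY, key hX, h.cov_eq (hZ.mdifferentiable (by simp) x),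
    θ.mvfderiv_mlieBracket hz hX hY]
  simp

end Parallelization

namespace Parallelization

variable {E : Type*} [NormedAddCommGroup E] [NormedSpace ℝ E] [FiniteDimensional ℝ E]
  {H : Type*} [TopologicalSpace H] {I : ModelWithCorners ℝ E H}
  {M : Type*} [TopologicalSpace M] [ChartedSpace H M] [IsManifold I ∞ M]
  {θ : Parallelization I M}

lemma hasDerivAt_trivialization_symm {γ : ℝ → M} {t : ℝ} (hγ : MDifferentiableAt 𝓘(ℝ, ℝ) I γ t)
    {δ : ℝ → E} {δ' : E} (hδ : HasDerivAt δ δ' t) (h0 : δ t = 0) :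
    HasDerivAt (fun s ↦ (trivializationAt E (TangentSpace I) (γ t)
      ⟨γ s, (θ.coord (γ s)).symm (δ s)⟩).2)
      (trivializationAt E (TangentSpace I) (γ t) ⟨γ t, (θ.coord (γ t)).symm δ'⟩).2 t := by
  set e := trivializationAt E (TangentSpace I) (γ t)
  have hmem : γ t ∈ e.baseSet := FiberBundle.mem_baseSet_trivializationAt' _
  have hlin {y : M} (hy : y ∈ e.baseSet) (a : E) : (e ⟨y, (θ.coord y).symm a⟩).2 =
      ∑ i, stdCoord E i a • (e ⟨y, θ.field (Module.finBasis ℝ E i) y⟩).2 := by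
    have h (v : TangentSpace I y) : (e ⟨y, v⟩).2 = e.continuousLinearMapAt ℝ y v := by
      rw [e.continuousLinearMapAt_apply ℝ, e.linearMapAt_apply, if_pos hy]
    simp only [h, θ.symm_eq_sum y a, map_sum, map_smul]
    rfl
  have hp (i) : DifferentiableAt ℝ (fun s ↦ (e ⟨γ s, θ.field (Module.finBasis ℝ E i) (γ s)⟩).2) t := by
    have h := (mdifferentiableAt_section I (θ.field (Module.finBasis ℝ E i))).1
      (θ.mdifferentiableAt_field (Module.finBasis ℝ E i) (γ t))
    exact (MDifferentiableAt.comp t h hγ).differentiableAt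
  have hδi (i) : HasDerivAt (fun s ↦ stdCoord E i (δ s)) (stdCoord E i δ') t :=
    (stdCoord E i).hasFDerivAt.comp_hasDerivAt t hδ
  have hsum := HasDerivAt.fun_sum (u := Finset.univ) fun i _ ↦ (hδi i).smul (hp i).hasDerivAt
  rw [hlin hmem]
  refine (hsum.congr_of_eventuallyEq ?_).congr_deriv ?_
  · filter_upwards [hγ.continuousAt.preimage_mem_nhds (e.open_baseSet.mem_nhds hmem)] with s hs
    exact hlin hs _
  · simp [h0]

/-- In a parallel frame, the covariant derivative along a curve is the derivative of the
coordinates. -/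
lemma IsParallelFor.covDerivAlong_eq [CompleteSpace E]
    {cov : CovariantDerivative I E (TangentSpace I : M → Type _)}
    (h : θ.IsParallelFor cov) {V : ℝ → TangentBundle I M} {t : ℝ}
    (hV : MDifferentiableAt 𝓘(ℝ, ℝ) I.tangent V t) :
    HasDerivAt (fun s ↦ θ.coord (V s).proj (V s).snd)
      (θ.coord (V t).proj (covDerivAlong cov V t)) t := by
  set e := trivializationAt E (TangentSpace I) (V t).proj with he
  have hmem : (V t).proj ∈ e.baseSet := FiberBundle.mem_baseSet_trivializationAt' _
  have hγ : MDifferentiableAt 𝓘(ℝ, ℝ) I (fun s ↦ (V s).proj) t :=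
    MDifferentiableAt.comp t ((contMDiff_proj (n := 1) (TangentSpace I)).mdifferentiable
      (by simp) (V t)) hV
  have hY : MDiffAt (T% (FiberBundle.extend E (V t).snd)) (V t).proj :=
    FiberBundle.mdifferentiableAt_extend ..
  have hc : DifferentiableAt ℝ (fun s ↦ θ.coord (V s).proj (V s).snd) t :=
    (MDifferentiableAt.comp t (θ.contMDiff_coord.mdifferentiable (by simp) (V t))
      hV).differentiableAt
  have hη := (mdifferentiableAt_coord_comp (θ := θ) hY)
  have hηγ : HasDerivAt (fun s ↦ θ.coord (V s).proj (FiberBundle.extend E (V t).snd (V s).proj))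
      (mvfderiv I (fun y ↦ θ.coord y (FiberBundle.extend E (V t).snd y)) (V t).proj
        (mfderiv 𝓘(ℝ, ℝ) I (fun s ↦ (V s).proj) t (1 : ℝ))) t := by
    exact hη.hasMFDerivAt_mvfderiv.comp_curve (γ := fun s ↦ (V s).proj) hγ
  have hδ := hc.hasDerivAt.fun_sub hηγ
  have hT := hasDerivAt_trivialization_symm (θ := θ) hγ hδ (by simp)
  have hev : (fun s ↦ (e (V s)).2) =ᶠ[𝓝 t] fun s ↦ (e (V t)).2 +
      (e ⟨(V s).proj, (θ.coord (V s).proj).symm (θ.coord (V s).proj (V s).snd -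
        θ.coord (V s).proj (FiberBundle.extend E (V t).snd (V s).proj))⟩).2 := by
    filter_upwards [hγ.continuousAt.preimage_mem_nhds (e.open_baseSet.mem_nhds hmem)] with s hs
    have hlin (v : TangentSpace I (V s).proj) :
        (e ⟨(V s).proj, v⟩).2 = e.continuousLinearMapAt ℝ (V s).proj v := by
      rw [e.continuousLinearMapAt_apply ℝ, e.linearMapAt_apply]
      exact (if_pos hs).symm
    have hext : (e ⟨(V s).proj, FiberBundle.extend E (V t).snd (V s).proj⟩).2 = (e (V t)).2 := by
      rw [FiberBundle.extend]
      change (e ⟨(V s).proj, e.symm (V s).proj (e (V t)).2⟩).2 = _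
      rw [e.apply_mk_symm hs]
    rw [← hext]
    simp only [map_sub, ContinuousLinearEquiv.symm_apply_apply, hlin]
    rw [add_sub_cancel]
  have hD := (hT.const_add (e (V t)).2).congr_of_eventuallyEq hev
  have hcov : covDerivAlong cov V t = (θ.coord (V t).proj).symm
      (deriv (fun s ↦ θ.coord (V s).proj (V s).snd) t) := by
    rw [covDerivAlong, hD.deriv, h.cov_eq hY]
    rw [e.symm_apply_apply_mk hmem]
    simp
  rw [hcov, ContinuousLinearEquiv.apply_symm_apply]
  exact hc.hasDerivAt

end Parallelization

namespace Parallelization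

variable {E : Type*} [NormedAddCommGroup E] [NormedSpace ℝ E] [FiniteDimensional ℝ E]
  [CompleteSpace E]
  {H : Type*} [TopologicalSpace H] {I : ModelWithCorners ℝ E H}
  {M : Type*} [TopologicalSpace M] [ChartedSpace H M] [IsManifold I ∞ M]
  {θ : Parallelization I M} {cov : CovariantDerivative I E (TangentSpace I : M → Type _)}

/-- The field with constant coordinates is parallel along every piecewise `C¹` curve. -/
lemma IsParallelFor.isParallelTransport_refl (h : θ.IsParallelFor cov) {γ : ℝ → M} {p : M}
    (hγ : IsPiecewiseC1 I γ) (h0 : γ 0 = p) (h1 : γ 1 = p) :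
    IsParallelTransport cov p γ (LinearEquiv.refl ℝ (TangentSpace I p)) := by
  intro v
  have hp : (⟨p, θ.field (θ.coord p v) p⟩ : TangentBundle I M) = ⟨p, v⟩ := by rw [θ.field_coord]
  refine ⟨fun t ↦ ⟨γ t, θ.field (θ.coord p v) (γ t)⟩, fun t _ ↦ rfl, ⟨?_, ?_⟩, ?_, ?_⟩
  · exact (θ.contMDiff_field _).continuous.comp_continuousOn hγ.1
  · obtain ⟨S, hS⟩ := hγ.2
    refine ⟨S, fun t ht htS ↦ ?_⟩
    have hnhds : Ioo 0 1 \ (S : Set ℝ) ∈ 𝓝 t :=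
      (isOpen_Ioo.sdiff S.finite_toSet.isClosed).mem_nhds ⟨ht, htS⟩
    obtain ⟨a, b, htab, hab, hsub⟩ := exists_Icc_mem_subset_of_mem_nhds hnhds
    have hlt : a < b := by
      rcases (htab.1.trans htab.2).lt_or_eq with h | rfl
      · exact h
      · rw [Icc_self] at hab
        simpa using mem_interior_iff_mem_nhds.2 hab
    have hC1 := hS a (Ioo_subset_Icc_self (hsub (left_mem_Icc.2 hlt.le)).1) b
      (Ioo_subset_Icc_self (hsub (right_mem_Icc.2 hlt.le)).1) hlt
      fun s hs hs' ↦ (hsub (Ioo_subset_Icc_self hs')).2 hs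
    have hγt : MDifferentiableAt 𝓘(ℝ, ℝ) I γ t := (hC1.contMDiffAt hab).mdifferentiableAt (by simp)
    have hV : MDifferentiableAt 𝓘(ℝ, ℝ) I.tangent
        (fun t ↦ (⟨γ t, θ.field (θ.coord p v) (γ t)⟩ : TangentBundle I M)) t :=
      MDifferentiableAt.comp t (θ.mdifferentiableAt_field _ _) hγt
    refine ⟨hV, ?_⟩
    have hd := h.covDerivAlong_eq hV
    simp only [θ.coord_field] at hd
    have := hd.unique (hasDerivAt_const t _)
    exact (θ.coord (γ t)).map_eq_zero_iff.1 this
  · rw [← hp, ← h0]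
  · rw [LinearEquiv.refl_apply, ← hp, ← h1]

lemma IsParallelFor.eq_one_of_isParallelTransport (h : θ.IsParallelFor cov) {γ : ℝ → M} {p : M}
    {A : TangentSpace I p ≃ₗ[ℝ] TangentSpace I p} (hA : IsParallelTransport cov p γ A) : A = 1 := by
  ext v
  obtain ⟨V, -, ⟨hVc, S, hS⟩, hV0, hV1⟩ := hA v
  have hint := MeasureTheory.integral_eq_of_hasDerivAt_off_countable_of_le
    (fun s ↦ θ.coord (V s).proj (V s).snd) (fun _ ↦ 0) zero_le_one S.countable_toSet
    (θ.contMDiff_coord.continuous.comp_continuousOn hVc)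
    (fun t ht ↦ by
      have := h.covDerivAlong_eq (hS t ht.1 ht.2).1
      rwa [(hS t ht.1 ht.2).2, map_zero] at this)
    (by simp)
  simp only [intervalIntegral.integral_zero] at hint
  rw [hV0, hV1, eq_comm, sub_eq_zero] at hint
  exact (θ.coord p).injective hint

lemma IsParallelFor.holonomyGroup_eq_bot (h : θ.IsParallelFor cov) (p : M) :
    holonomyGroup cov p = ⊥ := by
  rw [holonomyGroup, Subgroup.closure_eq_bot_iff]
  rintro A ⟨γ, -, -, -, hA⟩
  exact h.eq_one_of_isParallelTransport hA

end Parallelization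

section Gluing

/-- On a simply connected space, functions defined on the sets of an open cover whose differences
are locally constant are, up to locally constant functions, restrictions of one global function. -/
theorem exists_eventually_sub_eq_of_simplyConnected {X : Type*} [TopologicalSpace X]
    [SimplyConnectedSpace X] [LocallyPathConnectedSpace X] {V : Type*} [AddCommGroup V]
    (U : X → Set X) (hU : ∀ x, IsOpen (U x)) (hxU : ∀ x, x ∈ U x) (f : X → X → V)
    (hf : ∀ i j, ∀ x ∈ U i ∩ U j, ∀ᶠ y in 𝓝 x, f i y - f j y = f i x - f j x) :
    ∃ g : X → V, ∀ x, ∀ᶠ y in 𝓝 x, g y = f x y + (g x - f x x) := by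
  let _ : TopologicalSpace V := ⊥
  have : DiscreteTopology V := ⟨rfl⟩
  let Z : FiberBundleCore X X V :=
    { baseSet := U
      isOpen_baseSet := hU
      indexAt := id
      mem_baseSet_at := hxU
      coordChange := fun i j x v ↦ v + (f i x - f j x)
      coordChange_self := by simp
      continuousOn_coordChange := by
        rintro i j ⟨x, v⟩ ⟨hx, -⟩
        have hc : ContinuousAt (fun p : X × V ↦ p.2 + (f i x - f j x)) (x, v) :=
          (continuous_of_discreteTopology (f := fun w : V ↦ w + (f i x - f j x))).continuousAt.comp
            continuousAt_snd
        refine (hc.congr ?_).continuousWithinAt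
        filter_upwards [continuousAt_fst.eventually (hf i j x hx)] with p hp
        rw [hp]
      coordChange_comp := by
        intro i j k x hx v
        abel }
  have hcov : IsCoveringMap (TotalSpace.proj : TotalSpace V Z.Fiber → X) :=
    FiberBundle.isCoveringMap
  obtain ⟨x₀⟩ : Nonempty X := inferInstance
  obtain ⟨F, ⟨-, hF⟩, -⟩ := hcov.existsUnique_continuousMap_lifts (ContinuousMap.id X) x₀
    (⟨x₀, (0 : V)⟩ : TotalSpace V Z.Fiber) rfl
  have hproj (x : X) : (F x).proj = x := congrFun hF x
  let c (y : X) : V := (F y).snd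
  refine ⟨fun x ↦ c x + f x x, fun x ↦ ?_⟩
  have hmem : F x ∈ (Z.localTriv x).source := by
    rw [FiberBundleCore.mem_localTriv_source, hproj]
    exact hxU x
  have hcont : ContinuousAt (fun y ↦ (Z.localTriv x (F y)).2) x :=
    continuousAt_snd.comp (((Z.localTriv x).continuousOn_toFun.continuousAt
      ((Z.localTriv x).open_source.mem_nhds hmem)).comp F.continuous.continuousAt)
  have hval (y : X) : (Z.localTriv x (F y)).2 = c y + (f y y - f x y) := by
    change c y + (f (F y).proj (F y).proj - f x (F y).proj) = _
    rw [hproj]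
  have hev := hcont.eventually (discreteTopology_iff_singleton_mem_nhds.1 inferInstance _)
  filter_upwards [hev] with y hy
  simp only [hval, sub_self, add_zero] at hy
  rw [← hy]
  abel

end Gluing

section ExtChart

variable {E : Type*} [NormedAddCommGroup E] [NormedSpace ℝ E]
  {H : Type*} [TopologicalSpace H] {I : ModelWithCorners ℝ E H} [I.Boundaryless]
  {M : Type*} [TopologicalSpace M] [ChartedSpace H M] [IsManifold I ∞ M]

lemma contMDiffAt_extChartAt_symm {x : M} {e : E} (he : e ∈ (extChartAt I x).target) :
    ContMDiffAt 𝓘(ℝ, E) I ∞ (extChartAt I x).symm e :=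
  (contMDiffOn_extChartAt_symm x).contMDiffAt ((isOpen_extChartAt_target x).mem_nhds he)

lemma isInvertible_mfderiv_extChartAt_symm {x : M} {e : E} (he : e ∈ (extChartAt I x).target) :
    (mfderiv 𝓘(ℝ, E) I (extChartAt I x).symm e).IsInvertible := by
  have := isInvertible_mfderivWithin_extChartAt_symm (I := I) he
  rwa [I.range_eq_univ, mfderivWithin_univ] at this

lemma mfderiv_extChartAt_symm_comp {x y : M} (hy : y ∈ (extChartAt I x).source) :
    (mfderiv 𝓘(ℝ, E) I (extChartAt I x).symm (extChartAt I x y)) ∘L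
      (mfderiv I 𝓘(ℝ, E) (extChartAt I x) y) = ContinuousLinearMap.id ℝ _ := by
  have := mfderivWithin_extChartAt_symm_comp_mfderiv_extChartAt' (I := I) hy
  rwa [I.range_eq_univ, mfderivWithin_univ] at this

omit [I.Boundaryless] [IsManifold I ∞ M] in
lemma HasMFDerivAt.congr_deriv {V : Type*} [NormedAddCommGroup V] [NormedSpace ℝ V]
    {f : M → V} {x : M} {f₁ f₂ : TangentSpace I x →L[ℝ] V}
    (h : HasMFDerivAt I 𝓘(ℝ, V) f x f₁) (e : f₁ = f₂) : HasMFDerivAt I 𝓘(ℝ, V) f x f₂ :=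
  e ▸ h

/-- A function with vanishing derivative is locally constant. -/
lemma eventually_eq_of_hasMFDerivAt_zero {V : Type*} [NormedAddCommGroup V] [NormedSpace ℝ V]
    {f : M → V} {x : M}
    (hf : ∀ᶠ y in 𝓝 x, HasMFDerivAt I 𝓘(ℝ, V) f y (0 : TangentSpace I y →L[ℝ] V)) :
    ∀ᶠ y in 𝓝 x, f y = f x := by
  set φ := extChartAt I x
  have hx : φ.symm (φ x) = x := extChartAt_to_inv x
  have hcont : ContinuousAt φ.symm (φ x) := continuousAt_extChartAt_symm x
  have hev : ∀ᶠ e in 𝓝 (φ x), e ∈ φ.target ∧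
      HasMFDerivAt I 𝓘(ℝ, V) f (φ.symm e) (0 : TangentSpace I (φ.symm e) →L[ℝ] V) := by
    have h : ∀ᶠ y in 𝓝 (φ.symm (φ x)),
        HasMFDerivAt I 𝓘(ℝ, V) f y (0 : TangentSpace I y →L[ℝ] V) := by rwa [hx]
    exact Filter.Eventually.and (extChartAt_target_mem_nhds x) (hcont.eventually h)
  obtain ⟨r, hr, hball⟩ := Metric.eventually_nhds_iff_ball.1 hev
  have hd (e : E) (he : e ∈ Metric.ball (φ x) r) :
      HasFDerivAt (f ∘ φ.symm) (0 : E →L[ℝ] V) e := by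
    have h := HasMFDerivAt.comp e (hball e he).2
      ((contMDiffAt_extChartAt_symm (hball e he).1).mdifferentiableAt (by simp)).hasMFDerivAt
    exact h.hasFDerivAt.congr_fderiv rfl
  filter_upwards [extChartAt_source_mem_nhds (I := I) x,
    (continuousAt_extChartAt (I := I) x).preimage_mem_nhds (Metric.ball_mem_nhds _ hr)] with y hy hyr
  have := Metric.isOpen_ball.is_const_of_fderiv_eq_zero (convex_ball (φ x) r).isPreconnected
    (fun e he ↦ (hd e he).differentiableAt.differentiableWithinAt)
    (fun e he ↦ (hd e he).fderiv) hyr (Metric.mem_ball_self hr)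
  have hy' : φ.symm (φ y) = y := φ.left_inv hy
  exact (congrArg f hy').symm.trans (this.trans (congrArg f hx))

end ExtChart

namespace Parallelization

variable {E : Type*} [NormedAddCommGroup E] [NormedSpace ℝ E] [FiniteDimensional ℝ E]
  [CompleteSpace E]
  {H : Type*} [TopologicalSpace H] {I : ModelWithCorners ℝ E H}
  {M : Type*} [TopologicalSpace M] [ChartedSpace H M] [IsManifold I ∞ M]
  {V : Type*} [NormedAddCommGroup V] [NormedSpace ℝ V]

/-- The pullback along `ψ` of the one-form `L ∘ θ`. -/
def pullbackForm (θ : Parallelization I M) (L : E →L[ℝ] V) (ψ : E → M) (e : E) : E →L[ℝ] V :=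
  L ∘L (θ.coord (ψ e) : TangentSpace I (ψ e) →L[ℝ] E) ∘L mfderiv 𝓘(ℝ, E) I ψ e

variable {θ : Parallelization I M}

omit [CompleteSpace E] in
lemma contDiffOn_pullbackForm (L : E →L[ℝ] V) {ψ : E → M} {W : Set E} (hW : IsOpen W)
    (hψ : ContMDiffOn 𝓘(ℝ, E) I ∞ ψ W) : ContDiffOn ℝ ∞ (θ.pullbackForm L ψ) W := by
  rw [contDiffOn_clm_apply]
  intro u
  have h1 := hψ.contMDiffOn_tangentMapWithin (m := ∞) le_rfl hW.uniqueMDiffOn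
  have h2 : ContMDiff 𝓘(ℝ, E) 𝓘(ℝ, E).tangent ∞
      (fun e ↦ (⟨e, u⟩ : TangentBundle 𝓘(ℝ, E) E)) := fun e ↦
    contMDiffAt_vectorSpace_iff_contDiffAt.2 contDiffAt_const
  have h3 := θ.contMDiff_coord.comp_contMDiffOn (h1.comp h2.contMDiffOn (s := W) fun e he ↦ he)
  refine (L.contDiff.comp_contDiffOn h3.contDiffOn).congr fun e he ↦ ?_
  simp only [Function.comp_apply, tangentMapWithin, mfderivWithin_of_isOpen hW he]
  rfl

lemma fderiv_pullbackForm_symm (L : E →L[ℝ] V)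
    (hL : ∀ a b x, L (θ.coord x (mlieBracket I (θ.field a) (θ.field b) x)) = 0)
    {ψ : E → M} {W : Set E} (hW : IsOpen W) (hψ : ContMDiffOn 𝓘(ℝ, E) I ∞ ψ W)
    (hinv : ∀ e ∈ W, (mfderiv 𝓘(ℝ, E) I ψ e).IsInvertible) {e : E} (he : e ∈ W) (u v : E) :
    fderiv ℝ (θ.pullbackForm L ψ) e u v = fderiv ℝ (θ.pullbackForm L ψ) e v u := by
  have hle : minSmoothness ℝ 2 ≤ (∞ : ℕ∞ω) := by simp; exact ENat.LEInfty.out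
  have hmod : IsManifold I (minSmoothness ℝ 2) M := IsManifold.of_le (n := ∞) hle
  have hψe : ContMDiffAt 𝓘(ℝ, E) I ∞ ψ e := hψ.contMDiffAt (hW.mem_nhds he)
  let X (a : E) : E → E := mpullback 𝓘(ℝ, E) I ψ (θ.field a)
  have hXval {e : E} (he : e ∈ W) (a : E) : mfderiv 𝓘(ℝ, E) I ψ e (X a e) = θ.field a (ψ e) :=
    (hinv e he).self_apply_inverse _
  have hXsurj (u : E) : ∃ a, X a e = u :=
    ⟨θ.coord (ψ e) (mfderiv 𝓘(ℝ, E) I ψ e u), by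
      change (mfderiv 𝓘(ℝ, E) I ψ e).inverse (θ.field _ _) = u
      rw [θ.field_coord]
      exact (hinv e he).inverse_apply_self _⟩
  have hXd (a : E) : DifferentiableAt ℝ (X a) e := by
    have h := ContMDiffAt.mpullback_vectorField_preimage (m := 1) (n := 2) (f := ψ)
      (V := θ.field a) (x₀ := e) ((θ.contMDiff_field a).contMDiffAt.of_le ENat.LEInfty.out)
      (hψe.of_le ENat.LEInfty.out) (hinv e he) (by norm_num)
    exact (contMDiffAt_vectorSpace_iff_contDiffAt.1 h).differentiableAt (by simp)
  have hωd : DifferentiableAt ℝ (θ.pullbackForm L ψ) e :=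
    ((contDiffOn_pullbackForm L hW hψ).contDiffAt (hW.mem_nhds he)).differentiableAt (by simp)
  have hprod (a w : E) : fderiv ℝ (θ.pullbackForm L ψ) e w (X a e) =
      - θ.pullbackForm L ψ e (fderiv ℝ (X a) e w) := by
    have h1 := (hωd.hasFDerivAt.clm_apply (hXd a).hasFDerivAt)
    have h2 : HasFDerivAt (fun e ↦ θ.pullbackForm L ψ e (X a e)) (0 : E →L[ℝ] V) e := by
      refine (hasFDerivAt_const (L a) e).congr_of_eventuallyEq ?_
      filter_upwards [hW.mem_nhds he] with e' he'
      change L (θ.coord (ψ e') (mfderiv 𝓘(ℝ, E) I ψ e' (X a e'))) = L a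
      rw [hXval he', θ.coord_field]
    have h3 := congrArg (fun T : E →L[ℝ] V ↦ T w) (h1.unique h2)
    simp only [add_apply, ContinuousLinearMap.comp_apply,
      ContinuousLinearMap.flip_apply, zero_apply] at h3
    rw [eq_neg_iff_add_eq_zero, add_comm]
    exact h3
  obtain ⟨a, rfl⟩ := hXsurj u
  obtain ⟨b, rfl⟩ := hXsurj v
  rw [hprod, hprod, neg_inj, ← sub_eq_zero, ← map_sub]
  have hbr : fderiv ℝ (X b) e (X a e) - fderiv ℝ (X a) e (X b e) =
      mpullback 𝓘(ℝ, E) I ψ (mlieBracket I (θ.field a) (θ.field b)) e := by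
    rw [mpullback_mlieBracket (n := ∞) (θ.mdifferentiableAt_field _ _)
      (θ.mdifferentiableAt_field _ _) hψe hle]
    rw [← mlieBracketWithin_univ, mlieBracketWithin_eq_lieBracketWithin]
    exact (congrFun (lieBracketWithin_univ (V := X a) (W := X b)) e).symm
  rw [hbr]
  change L (θ.coord (ψ e) (mfderiv 𝓘(ℝ, E) I ψ e ((mfderiv 𝓘(ℝ, E) I ψ e).inverse _))) = 0
  rw [(hinv e he).self_apply_inverse]
  exact hL a b _

/-- Poincaré lemma: a one-form with constant coefficients that vanishes on brackets of coordinate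
fields is locally exact. -/
lemma exists_local_primitive [I.Boundaryless] [CompleteSpace V] (L : E →L[ℝ] V)
    (hL : ∀ a b x, L (θ.coord x (mlieBracket I (θ.field a) (θ.field b) x)) = 0) (x : M) :
    ∃ (f : M → V) (U : Set M), IsOpen U ∧ x ∈ U ∧ ∀ y ∈ U, CMDiffAt ∞ f y ∧
      HasMFDerivAt I 𝓘(ℝ, V) f y (L ∘L (θ.coord y : TangentSpace I y →L[ℝ] E)) := by
  set φ := extChartAt I x
  obtain ⟨r, hr, hball⟩ := Metric.mem_nhds_iff.1 (extChartAt_target_mem_nhds (I := I) x)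
  have hψ : ContMDiffOn 𝓘(ℝ, E) I ∞ φ.symm (Metric.ball (φ x) r) :=
    (contMDiffOn_extChartAt_symm x).mono hball
  have hω := contDiffOn_pullbackForm (θ := θ) L Metric.isOpen_ball hψ
  obtain ⟨f, hf⟩ := (convex_ball (φ x) r).exists_forall_hasFDerivAt_of_fderiv_symmetric (𝕜 := ℝ)
    Metric.isOpen_ball (hω.differentiableOn (by simp))
    fun e he ↦ fderiv_pullbackForm_symm L hL Metric.isOpen_ball hψ
      (fun e he ↦ isInvertible_mfderiv_extChartAt_symm (hball he)) he
  have hfs : ContDiffOn ℝ ∞ f (Metric.ball (φ x) r) := by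
    rw [contDiffOn_infty_iff_fderiv_of_isOpen Metric.isOpen_ball]
    exact ⟨fun e he ↦ (hf e he).differentiableAt.differentiableWithinAt,
      hω.congr fun e he ↦ (hf e he).fderiv⟩
  refine ⟨f ∘ φ, φ.source ∩ φ ⁻¹' Metric.ball (φ x) r,
    (continuousOn_extChartAt x).isOpen_inter_preimage (isOpen_extChartAt_source x)
      Metric.isOpen_ball, ⟨mem_extChartAt_source x, Metric.mem_ball_self hr⟩, fun y hy ↦ ?_⟩
  have hφ : CMDiffAt ∞ φ y := contMDiffAt_extChartAt' (by rw [← extChartAt_source I]; exact hy.1)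
  refine ⟨(hfs.contDiffAt (Metric.isOpen_ball.mem_nhds hy.2)).contMDiffAt.comp y hφ, ?_⟩
  have h := HasMFDerivAt.comp y (hf _ hy.2).hasMFDerivAt
    (hφ.mdifferentiableAt (by simp)).hasMFDerivAt
  convert! h using 1
  have h1 := mfderiv_extChartAt_symm_comp (I := I) hy.1
  have h2 : φ.symm (φ y) = y := φ.left_inv hy.1
  ext w
  have h3 : (mfderiv 𝓘(ℝ, E) I φ.symm (φ y) (mfderiv I 𝓘(ℝ, E) φ y w) : E) = w :=
    congrArg (fun T : E →L[ℝ] E ↦ T w) h1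
  have h4 (z : M) (hz : z = y) (u : E) (hu : u = w) :
      L (θ.coord y w) = L ((θ.coord z : TangentSpace I z →L[ℝ] E) u) := by subst hz hu; rfl
  exact h4 _ h2 _ h3

/-- On a simply connected manifold, a one-form with constant coefficients that vanishes on brackets
of coordinate fields is exact. -/
theorem exists_primitive [I.Boundaryless] [CompleteSpace V] [SimplyConnectedSpace M]
    (L : E →L[ℝ] V)
    (hL : ∀ a b x, L (θ.coord x (mlieBracket I (θ.field a) (θ.field b) x)) = 0) :
    ∃ f : M → V, CMDiff ∞ f ∧
      ∀ y, HasMFDerivAt I 𝓘(ℝ, V) f y (L ∘L (θ.coord y : TangentSpace I y →L[ℝ] E)) := by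
  have : LocallyPathConnectedSpace H :=
    I.toHomeomorph.isOpenEmbedding.locallyPathConnectedSpace
  have : LocallyPathConnectedSpace M := ChartedSpace.locallyPathConnectedSpace H M
  choose f U hU hxU hf using exists_local_primitive (θ := θ) L hL
  obtain ⟨g, hg⟩ := exists_eventually_sub_eq_of_simplyConnected U hU hxU f (by
    intro i j x hx
    refine eventually_eq_of_hasMFDerivAt_zero (I := I) (f := fun y ↦ f i y - f j y) ?_
    filter_upwards [((hU i).inter (hU j)).mem_nhds hx] with y hy
    have := (hf i y hy.1).2.sub (hf j y hy.2).2
    exact this.congr_deriv (sub_self (G := E →L[ℝ] V) _))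
  refine ⟨g, fun x ↦ ?_, fun x ↦ ?_⟩
  · refine ContMDiffAt.congr_of_eventuallyEq ?_ (hg x)
    exact (hf x x (hxU x)).1.add contMDiffAt_const
  · refine HasMFDerivAt.congr_of_eventuallyEq (f := fun y ↦ f x y + (g x - f x x)) ?_ (hg x)
    exact ((hf x x (hxU x)).2.add (hasMFDerivAt_const (g x - f x x) x)).congr_deriv
      (add_zero (M := E →L[ℝ] V) _)

end Parallelization

section HomSection

variable {E : Type*} [NormedAddCommGroup E] [NormedSpace ℝ E] [FiniteDimensional ℝ E]
  {H : Type*} [TopologicalSpace H] {I : ModelWithCorners ℝ E H}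
  {M : Type*} [TopologicalSpace M] [ChartedSpace H M]
  {F : Type*} [NormedAddCommGroup F] [NormedSpace ℝ F]

lemma Parallelization.sum_stdCoord_smul (a : E) :
    ∑ i, Parallelization.stdCoord E i a • Module.finBasis ℝ E i = a :=
  (Module.finBasis ℝ E).sum_repr a

lemma contMDiffAt_clm_of_forall_apply {n : ℕ∞ω} {f : M → E →L[ℝ] F} {x : M}
    (h : ∀ a, CMDiffAt n (fun y ↦ f y a) x) : CMDiffAt n f x := by
  have h1 : f = fun y ↦ ∑ i, ContinuousLinearMap.smulRightL ℝ E F (Parallelization.stdCoord E i)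
      (f y (Module.finBasis ℝ E i)) := by
    ext y a
    conv_lhs => rw [← Parallelization.sum_stdCoord_smul a, map_sum]
    simp
  rw [h1]
  exact ContMDiffAt.sum fun i _ ↦ (h _).continuousLinearMap_comp _

variable [IsManifold I ∞ M]

/-- A field of endomorphisms of the tangent spaces is smooth if it maps smooth vector fields to
smooth vector fields. -/
lemma contMDiffAt_hom_of_forall_apply {A : Π x : M, TangentSpace I x →L[ℝ] TangentSpace I x}
    {x : M} (hA : ∀ X : Π x : M, TangentSpace I x, CMDiffAt ∞ (T% X) x →
      CMDiffAt ∞ (T% (fun y ↦ A y (X y))) x) :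
    ContMDiffAt I (I.prod 𝓘(ℝ, E →L[ℝ] E)) ∞ (fun y ↦
      (⟨y, A y⟩ : TotalSpace (E →L[ℝ] E) fun y : M ↦ TangentSpace I y →L[ℝ] TangentSpace I y)) x := by
  rw [contMDiffAt_hom_bundle]
  refine ⟨contMDiffAt_id, contMDiffAt_clm_of_forall_apply fun a ↦ ?_⟩
  let t := trivializationAt E (TangentSpace I : M → Type _) x
  have hx : x ∈ t.baseSet := FiberBundle.mem_baseSet_trivializationAt' x
  have hX : CMDiffAt ∞ (T% (fun y ↦ t.symm y a)) x := by
    rw [contMDiffAt_section]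
    refine (contMDiffAt_const (c := a)).congr_of_eventuallyEq ?_
    filter_upwards [t.open_baseSet.mem_nhds hx] with y hy
    exact congrArg Prod.snd (t.apply_mk_symm hy a)
  have h := (contMDiffAt_section (IB := I) x).1 (hA _ hX)
  refine h.congr_of_eventuallyEq ?_
  filter_upwards [t.open_baseSet.mem_nhds hx] with y hy
  rw [ContinuousLinearMap.inCoordinates_eq hy hy]
  rfl

end HomSection

namespace Parallelization

variable {E : Type*} [NormedAddCommGroup E] [NormedSpace ℝ E]
  {H : Type*} [TopologicalSpace H] {I : ModelWithCorners ℝ E H}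
  {M : Type*} [TopologicalSpace M] [ChartedSpace H M] [IsManifold I ∞ M]

/-- The connection with `∇_X Y = θ⁻¹ (X (θ Y) + Γ (θ X) (θ Y))`. -/
def connection (θ : Parallelization I M) (Γ : E →L[ℝ] E →L[ℝ] E) :
    CovariantDerivative I E (TangentSpace I : M → Type _) where
  toFun σ x := ((θ.coord x).symm : E →L[ℝ] TangentSpace I x) ∘L
    (mvfderiv I (fun y ↦ θ.coord y (σ y)) x +
      Γ.flip (θ.coord x (σ x)) ∘L (θ.coord x : TangentSpace I x →L[ℝ] E))
  isCovariantDerivativeOnUniv :=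
    { add := by
        intro σ σ' x hσ hσ' _
        have h : mvfderiv I (fun y ↦ θ.coord y (σ y) + θ.coord y (σ' y)) x =
            mvfderiv I (fun y ↦ θ.coord y (σ y)) x + mvfderiv I (fun y ↦ θ.coord y (σ' y)) x :=
          mvfderiv_add (mdifferentiableAt_coord_comp hσ) (mdifferentiableAt_coord_comp hσ')
        ext v
        simp [h]
        abel
      leibniz := by
        intro σ g x hσ hg _
        have h : mvfderiv I (fun y ↦ g y • θ.coord y (σ y)) x =
            g x • mvfderiv I (fun y ↦ θ.coord y (σ y)) x +
              (mvfderiv I g x).smulRight (θ.coord x (σ x)) :=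
          mvfderiv_smul hg (mdifferentiableAt_coord_comp hσ)
        ext v
        simp [h]
        abel }

variable (θ : Parallelization I M) (Γ : E →L[ℝ] E →L[ℝ] E)

lemma connection_apply (σ : Π x : M, TangentSpace I x) (x : M) (v : TangentSpace I x) :
    θ.connection Γ σ x v = (θ.coord x).symm (mvfderiv I (fun y ↦ θ.coord y (σ y)) x v +
      Γ (θ.coord x v) (θ.coord x (σ x))) := rfl

lemma connection_field (a : E) (x : M) (v : TangentSpace I x) :
    θ.connection Γ (θ.field a) x v = θ.field (Γ (θ.coord x v) a) x := by
  rw [connection_apply]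
  simp only [coord_field, mvfderiv_const]
  simp [field]

variable [FiniteDimensional ℝ E]

lemma contMDiffCovariantDerivative_connection :
    CovariantDerivative.ContMDiffCovariantDerivative (θ.connection Γ) ∞ where
  contMDiff :=
    { contMDiff := by
        intro σ hσ
        replace hσ : CMDiff ∞ (T% σ) := contMDiffOn_univ.1 (by simpa using hσ)
        rw [contMDiffOn_univ]
        refine fun x ↦ contMDiffAt_hom_of_forall_apply fun X hX ↦ ?_
        refine contMDiffAt_symm_comp le_rfl ?_
        refine (ContMDiffAt.mvfderiv_apply (contMDiff_coord_comp hσ) hX).add ?_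
        have hX' : CMDiffAt ∞ (fun y ↦ θ.coord y (X y)) x :=
          θ.contMDiff_coord.contMDiffAt.comp x hX
        exact (hX'.continuousLinearMap_comp Γ).clm_apply (contMDiff_coord_comp hσ x) }

variable [CompleteSpace E]

variable {Γ} in
lemma torsion_connection (h : ∀ a b x, θ.coord x (mlieBracket I (θ.field a) (θ.field b) x) =
    Γ a b - Γ b a) : (θ.connection Γ).torsion = 0 := by
  ext x u v
  have := (θ.connection Γ).torsion_apply (θ.mdifferentiableAt_field (θ.coord x u) x)
    (θ.mdifferentiableAt_field (θ.coord x v) x)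
  rw [θ.field_coord, θ.field_coord, connection_field, connection_field,
    ← θ.field_coord (mlieBracket I _ _ _), h] at this
  rw [this]
  simp [field]

end Parallelization

section LieGroup

variable {E : Type*} [NormedAddCommGroup E] [NormedSpace ℝ E]
  {H : Type*} [TopologicalSpace H] (I : ModelWithCorners ℝ E H)
  {N : Type*} [TopologicalSpace N] [ChartedSpace H N] [Group N]

/-- The derivative at `x` of left multiplication by `g`, read in the model space. -/
def mulLeftDeriv (g x : N) : E →L[ℝ] E := mfderiv I I (fun y ↦ g * y) x

/-- The derivative at `x` of right multiplication by `g`, read in the model space. -/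
def mulRightDeriv (g x : N) : E →L[ℝ] E := mfderiv I I (fun y ↦ y * g) x

variable [LieGroup I ∞ N]

lemma hasMFDerivAt_mul_left (g x : N) :
    HasMFDerivAt I I (fun y ↦ g * y) x (mulLeftDeriv (E := E) I g x) :=
  ((contMDiff_mul_left (I := I) (n := ∞) (a := g)).mdifferentiable (by simp) x).hasMFDerivAt

lemma hasMFDerivAt_mul_right (g x : N) :
    HasMFDerivAt I I (fun y ↦ y * g) x (mulRightDeriv (E := E) I g x) :=
  ((contMDiff_mul_right (I := I) (n := ∞) (a := g)).mdifferentiable (by simp) x).hasMFDerivAt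

omit [LieGroup I ∞ N] in
lemma mulLeftDeriv_one (x : N) : mulLeftDeriv I 1 x = ContinuousLinearMap.id ℝ E := by
  have h : (fun y : N ↦ 1 * y) = id := funext one_mul
  unfold mulLeftDeriv
  rw [h]
  exact mfderiv_id

omit [LieGroup I ∞ N] in
lemma mulRightDeriv_one (x : N) : mulRightDeriv I 1 x = ContinuousLinearMap.id ℝ E := by
  have h : (fun y : N ↦ y * 1) = id := funext mul_one
  unfold mulRightDeriv
  rw [h]
  exact mfderiv_id

lemma mulLeftDeriv_mul (g h x : N) :
    mulLeftDeriv I (g * h) x = mulLeftDeriv I g (h * x) ∘L mulLeftDeriv I h x := by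
  have h1 := HasMFDerivAt.comp x (hasMFDerivAt_mul_left I g (h * x)) (hasMFDerivAt_mul_left I h x)
  have h2 : ((fun y ↦ g * y) ∘ fun y ↦ h * y) = fun y ↦ g * h * y := by
    ext y
    exact (mul_assoc g h y).symm
  rw [h2] at h1
  exact h1.mfderiv

lemma mulLeftDeriv_comp_inv (x : N) :
    mulLeftDeriv I x 1 ∘L mulLeftDeriv I x⁻¹ x = ContinuousLinearMap.id ℝ E := by
  have h := mulLeftDeriv_mul I x x⁻¹ x
  rwa [mul_inv_cancel, inv_mul_cancel, mulLeftDeriv_one, eq_comm] at h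

lemma mulLeftDeriv_inv_comp (x : N) :
    mulLeftDeriv I x⁻¹ x ∘L mulLeftDeriv I x 1 = ContinuousLinearMap.id ℝ E := by
  have h := mulLeftDeriv_mul I x⁻¹ x 1
  rwa [inv_mul_cancel, mul_one, mulLeftDeriv_one, eq_comm] at h

/-- The tangent map of the multiplication of a Lie group is smooth. -/
lemma contMDiff_tangent_mul : ContMDiff (I.tangent.prod I.tangent) I.tangent ∞
    (fun p : TangentBundle I N × TangentBundle I N ↦ (⟨p.1.proj * p.2.proj,
      (mulRightDeriv I p.2.proj p.1.proj p.1.snd + mulLeftDeriv I p.1.proj p.2.proj p.2.snd : E)⟩ :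
      TangentBundle I N)) := by
  have h1 : ContMDiff (I.prod I).tangent I.tangent ∞
      (tangentMap (I.prod I) I (fun p : N × N ↦ p.1 * p.2)) :=
    (contMDiff_mul I ∞).contMDiff_tangentMap (m := ∞) le_rfl
  have h2 := h1.comp (contMDiff_equivTangentBundleProd_symm (I := I) (M := N) (I' := I) (M' := N))
  convert! h2 with p
  simp only [Function.comp_apply, tangentMap]
  rw [mfderiv_prod_eq_add_apply ((contMDiff_mul I ∞).mdifferentiable (by simp) _)]
  rfl

lemma contMDiff_mulLeftDeriv {E' : Type*} [NormedAddCommGroup E'] [NormedSpace ℝ E']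
    {H' : Type*} [TopologicalSpace H'] {J : ModelWithCorners ℝ E' H'}
    {P : Type*} [TopologicalSpace P] [ChartedSpace H' P] {g : P → N} {V : P → TangentBundle I N}
    (hg : ContMDiff J I ∞ g) (hV : ContMDiff J I.tangent ∞ V) :
    ContMDiff J I.tangent ∞ (fun p ↦ (⟨g p * (V p).proj,
      mulLeftDeriv I (g p) (V p).proj (V p).snd⟩ : TangentBundle I N)) := by
  have h1 : ContMDiff J I.tangent ∞ (fun p ↦ (⟨g p, (0 : E)⟩ : TangentBundle I N)) :=
    (contMDiff_zeroSection ℝ (TangentSpace I : N → Type _)).comp hg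
  convert! (contMDiff_tangent_mul I).comp (h1.prodMk hV) with p
  simp

lemma contMDiff_mulRightDeriv {E' : Type*} [NormedAddCommGroup E'] [NormedSpace ℝ E']
    {H' : Type*} [TopologicalSpace H'] {J : ModelWithCorners ℝ E' H'}
    {P : Type*} [TopologicalSpace P] [ChartedSpace H' P] {g : P → N} {V : P → TangentBundle I N}
    (hg : ContMDiff J I ∞ g) (hV : ContMDiff J I.tangent ∞ V) :
    ContMDiff J I.tangent ∞ (fun p ↦ (⟨(V p).proj * g p,
      mulRightDeriv I (g p) (V p).proj (V p).snd⟩ : TangentBundle I N)) := by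
  have h1 : ContMDiff J I.tangent ∞ (fun p ↦ (⟨g p, (0 : E)⟩ : TangentBundle I N)) :=
    (contMDiff_zeroSection ℝ (TangentSpace I : N → Type _)).comp hg
  convert! (contMDiff_tangent_mul I).comp (hV.prodMk h1) with p
  simp

omit [Group N] [LieGroup I ∞ N] in
lemma TangentBundle.mk_congr {x y : N} (h : x = y) (v : E) :
    (⟨x, v⟩ : TangentBundle I N) = ⟨y, v⟩ := by
  rw [h]

lemma contMDiff_snd_of_proj_eq {E' : Type*} [NormedAddCommGroup E'] [NormedSpace ℝ E']
    {H' : Type*} [TopologicalSpace H'] {J : ModelWithCorners ℝ E' H'}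
    {P : Type*} [TopologicalSpace P] [ChartedSpace H' P] {x : N} {f : P → E}
    (hf : ContMDiff J I.tangent ∞ (fun p ↦ (⟨x, f p⟩ : TangentBundle I N))) :
    ContMDiff J 𝓘(ℝ, E) ∞ f := by
  intro p
  have h := ((contMDiffAt_totalSpace (IB := I)).1 (hf p)).2
  let t := trivializationAt E (TangentSpace I : N → Type _) x
  have hx : x ∈ t.baseSet := FiberBundle.mem_baseSet_trivializationAt' x
  let e : E →L[ℝ] E := ((t.continuousLinearEquivAt ℝ x hx).symm : E →L[ℝ] TangentSpace I x)
  have he (v : E) : e (t ⟨x, v⟩).2 = v :=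
    (t.continuousLinearEquivAt ℝ x hx).symm_apply_apply v
  exact (h.continuousLinearMap_comp e).congr_of_eventuallyEq (.of_forall fun q ↦ (he _).symm)

variable (N) in
/-- The parallelization of a Lie group by left-invariant vector fields. -/
def leftParallelization : Parallelization I N where
  coord x := ContinuousLinearEquiv.equivOfInverse (M₁ := TangentSpace I x) (M₂ := E)
    (mulLeftDeriv (E := E) I x⁻¹ x) (mulLeftDeriv (E := E) I x 1)
    (fun v ↦ congrArg (fun T : E →L[ℝ] E ↦ T v) (mulLeftDeriv_comp_inv I x))
    (fun v ↦ congrArg (fun T : E →L[ℝ] E ↦ T v) (mulLeftDeriv_inv_comp I x))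
  contMDiff_coord := by
    refine contMDiff_snd_of_proj_eq I (x := (1 : N)) ?_
    have h1 : ContMDiff I.tangent I ∞ (fun W : TangentBundle I N ↦ W.proj⁻¹) :=
      (contMDiff_inv I ∞).comp (contMDiff_proj _)
    convert! contMDiff_mulLeftDeriv I h1 contMDiff_id with W
    exact TangentBundle.mk_congr I (inv_mul_cancel W.proj).symm _
  contMDiff_symm a := by
    have h := contMDiff_mulLeftDeriv I (N := N) contMDiff_id
      (contMDiff_const (c := (⟨1, a⟩ : TangentBundle I N)))
    convert! h with x
    exact TangentBundle.mk_congr I (mul_one x).symm _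

end LieGroup

section CongrPoint

variable {E : Type*} [NormedAddCommGroup E] [NormedSpace ℝ E]
  {H : Type*} [TopologicalSpace H] {I : ModelWithCorners ℝ E H}
  {M : Type*} [TopologicalSpace M] [ChartedSpace H M]
  {E' : Type*} [NormedAddCommGroup E'] [NormedSpace ℝ E']
  {H' : Type*} [TopologicalSpace H'] {I' : ModelWithCorners ℝ E' H'}
  {M' : Type*} [TopologicalSpace M'] [ChartedSpace H' M']

lemma HasMFDerivAt.congr_point {f : M → M'} {x y : M} {f' : E →L[ℝ] E'}
    (h : HasMFDerivAt I I' f x (f' : TangentSpace I x →L[ℝ] TangentSpace I' (f x))) (hxy : x = y) :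
    HasMFDerivAt I I' f y (f' : TangentSpace I y →L[ℝ] TangentSpace I' (f y)) := by
  subst hxy
  exact h

end CongrPoint

section LieGroup

variable {E : Type*} [NormedAddCommGroup E] [NormedSpace ℝ E]
  {H : Type*} [TopologicalSpace H] (I : ModelWithCorners ℝ E H)
  {N : Type*} [TopologicalSpace N] [ChartedSpace H N] [Group N] [LieGroup I ∞ N]

/-- The right-invariant vector field with value `b` at the identity. -/
def rightInvariantField (b : E) (x : N) : TangentSpace I x := mulRightDeriv (E := E) I x 1 b

lemma contMDiff_rightInvariantField (b : E) :
    CMDiff ∞ (T% (rightInvariantField I b : Π x : N, TangentSpace I x)) := by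
  have h := contMDiff_mulRightDeriv I (N := N) contMDiff_id
    (contMDiff_const (c := (⟨1, b⟩ : TangentBundle I N)))
  convert! h with x
  exact TangentBundle.mk_congr I (one_mul x).symm _

lemma leftParallelization_field (a : E) (x : N) :
    (leftParallelization I N).field a x = (mulLeftDeriv (E := E) I x 1 a : TangentSpace I x) := rfl

lemma leftParallelization_coord (x : N) (v : TangentSpace I x) :
    (leftParallelization I N).coord x v = mulLeftDeriv (E := E) I x⁻¹ x v := rfl

lemma leftParallelization_field_one (a : E) : (leftParallelization I N).field a 1 = a := by
  rw [leftParallelization_field, mulLeftDeriv_one]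
  rfl

lemma leftParallelization_coord_one (v : TangentSpace I (1 : N)) :
    (leftParallelization I N).coord 1 v = v := by
  rw [leftParallelization_coord, inv_one, mulLeftDeriv_one]
  rfl

omit [LieGroup I ∞ N] in
lemma rightInvariantField_one (b : E) : rightInvariantField I b (1 : N) = b := by
  rw [rightInvariantField, mulRightDeriv_one]
  rfl

variable [I.Boundaryless]

/-- The multiplication of `N`, read in the chart at the identity. -/
def chartMul (N : Type*) [TopologicalSpace N] [ChartedSpace H N] [Group N] (p : E × E) : E :=
  extChartAt I (1 : N) ((extChartAt I (1 : N)).symm p.1 * (extChartAt I (1 : N)).symm p.2)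

lemma contDiffAt_chartMul {p : E × E} (h1 : p.1 ∈ (extChartAt I (1 : N)).target)
    (h2 : p.2 ∈ (extChartAt I (1 : N)).target)
    (h3 : (extChartAt I (1 : N)).symm p.1 * (extChartAt I (1 : N)).symm p.2 ∈
      (extChartAt I (1 : N)).source) : ContDiffAt ℝ ∞ (chartMul I N) p := by
  have e1 : ContMDiffAt 𝓘(ℝ, E × E) I ∞ (fun p : E × E ↦ (extChartAt I (1 : N)).symm p.1) p :=
    (contMDiffAt_extChartAt_symm h1).comp p contDiff_fst.contMDiff.contMDiffAt
  have e2 : ContMDiffAt 𝓘(ℝ, E × E) I ∞ (fun p : E × E ↦ (extChartAt I (1 : N)).symm p.2) p :=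
    (contMDiffAt_extChartAt_symm h2).comp p contDiff_snd.contMDiff.contMDiffAt
  exact (ContMDiffAt.comp p (contMDiffAt_extChartAt' (by rwa [← extChartAt_source I]))
    (e1.mul e2)).contDiffAt

variable [CompleteSpace E]

/-- Left- and right-invariant vector fields commute at the identity. -/
theorem mlieBracket_left_right (a b : E) :
    mlieBracket I ((leftParallelization I N).field a) (rightInvariantField I b) (1 : N) = 0 := by
  have hle : minSmoothness ℝ 2 ≤ (∞ : ℕ∞ω) := by simp; exact ENat.LEInfty.out
  have hmod : IsManifold I (minSmoothness ℝ 2) N := IsManifold.of_le (n := ∞) hle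
  set θ := leftParallelization I N
  set φ := extChartAt I (1 : N) with hφ
  set o : E := φ 1
  have ho : o ∈ φ.target := mem_extChartAt_target 1
  have hψo : φ.symm o = 1 := extChartAt_to_inv 1
  let P (u : E) : E →L[ℝ] E := mfderiv 𝓘(ℝ, E) I φ.symm u
  let D (u : E) : E →L[ℝ] E := mfderiv I 𝓘(ℝ, E) φ (φ.symm u)
  have hP {u : E} (hu : u ∈ φ.target) : (P u).IsInvertible :=
    isInvertible_mfderiv_extChartAt_symm hu
  have hD {u : E} (hu : u ∈ φ.target) (w : E) : (P u).inverse w = D u w := by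
    have := mfderivWithin_extChartAt_symm_comp_mfderiv_extChartAt (I := I) hu
    rw [I.range_eq_univ, mfderivWithin_univ] at this
    rw [(hP hu).inverse_apply_eq]
    exact (congrArg (fun T : E →L[ℝ] E ↦ T w) this).symm
  have hPd {u : E} (hu : u ∈ φ.target) : HasMFDerivAt 𝓘(ℝ, E) I φ.symm u (P u) :=
    ((contMDiffAt_extChartAt_symm hu).mdifferentiableAt (by simp)).hasMFDerivAt
  have hDd {u : E} (hu : u ∈ φ.target) : HasMFDerivAt I 𝓘(ℝ, E) φ (φ.symm u) (D u) :=
    ((contMDiffAt_extChartAt' (n := ∞) (by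
      rw [← extChartAt_source I]; exact φ.map_target hu)).mdifferentiableAt (by simp)).hasMFDerivAt
  let F := chartMul I N
  have hF1 {u : E} (hu : u ∈ φ.target) : ContDiffAt ℝ ∞ F (u, o) :=
    contDiffAt_chartMul I hu ho (by
      change φ.symm u * φ.symm o ∈ φ.source
      rw [hψo, mul_one]; exact φ.map_target hu)
  have hF2 {u : E} (hu : u ∈ φ.target) : ContDiffAt ℝ ∞ F (o, u) :=
    contDiffAt_chartMul I ho hu (by
      change φ.symm o * φ.symm u ∈ φ.source
      rw [hψo, one_mul]; exact φ.map_target hu)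
  let X : E → E := mpullback 𝓘(ℝ, E) I φ.symm (θ.field a)
  let Y : E → E := mpullback 𝓘(ℝ, E) I φ.symm (rightInvariantField I b)
  have hPX : P o (X o) = a := by
    have h : ∀ z : N, z = 1 → (θ.field a z : E) = a := by
      rintro _ rfl
      exact leftParallelization_field_one I a
    exact ((hP ho).self_apply_inverse _).trans (h _ hψo)
  have hPY : P o (Y o) = b := by
    have h : ∀ z : N, z = 1 → (rightInvariantField I b z : E) = b := by
      rintro _ rfl
      exact rightInvariantField_one I b
    exact ((hP ho).self_apply_inverse _).trans (h _ hψo)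
  have htarget : φ.target ∈ 𝓝 o := extChartAt_target_mem_nhds 1
  have hX {u : E} (hu : u ∈ φ.target) : X u = fderiv ℝ F (u, o) (0, X o) := by
    have h1 := HasMFDerivAt.comp o ((hasMFDerivAt_mul_left I (φ.symm u) 1).congr_point hψo.symm)
      (hPd ho)
    have h2 := HasMFDerivAt.comp o ((hDd hu).congr_point (y := φ.symm u * φ.symm o)
      (by rw [hψo, mul_one])) h1
    have h3 : HasFDerivAt (fun v ↦ F (u, v)) (D u ∘L mulLeftDeriv (E := E) I (φ.symm u) 1 ∘L P o) o :=
      h2.hasFDerivAt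
    have h4 : HasFDerivAt (fun v ↦ F (u, v)) (fderiv ℝ F (u, o) ∘L .inr ℝ E E) o :=
      (((hF1 hu).differentiableAt (by simp)).hasFDerivAt).comp o (hasFDerivAt_prodMk_right u o)
    refine Eq.trans (hD hu _) ?_
    refine Eq.trans ?_ (congrArg (fun T : E →L[ℝ] E ↦ T (X o)) (h3.unique h4))
    change D u (mulLeftDeriv (E := E) I (φ.symm u) 1 a) =
      D u (mulLeftDeriv (E := E) I (φ.symm u) 1 (P o (X o)))
    rw [hPX]
  have hY {u : E} (hu : u ∈ φ.target) : Y u = fderiv ℝ F (o, u) (Y o, 0) := by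
    have h1 := HasMFDerivAt.comp o ((hasMFDerivAt_mul_right I (φ.symm u) 1).congr_point hψo.symm)
      (hPd ho)
    have h2 := HasMFDerivAt.comp o ((hDd hu).congr_point (y := φ.symm o * φ.symm u)
      (by rw [hψo, one_mul])) h1
    have h3 : HasFDerivAt (fun v ↦ F (v, u))
        (D u ∘L mulRightDeriv (E := E) I (φ.symm u) 1 ∘L P o) o := h2.hasFDerivAt
    have h4 : HasFDerivAt (fun v ↦ F (v, u)) (fderiv ℝ F (o, u) ∘L .inl ℝ E E) o :=
      HasFDerivAt.comp (f := fun v ↦ (v, u)) o ((hF2 hu).differentiableAt (by simp)).hasFDerivAt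
        (hasFDerivAt_prodMk_left o u)
    refine Eq.trans (hD hu _) ?_
    refine Eq.trans ?_ (congrArg (fun T : E →L[ℝ] E ↦ T (Y o)) (h3.unique h4))
    change D u (mulRightDeriv (E := E) I (φ.symm u) 1 b) =
      D u (mulRightDeriv (E := E) I (φ.symm u) 1 (P o (Y o)))
    rw [hPY]
  have hdF : DifferentiableAt ℝ (fderiv ℝ F) (o, o) :=
    ((hF1 ho).fderiv_right (m := 1) (by rw [one_add_one_eq_two]; exact ENat.LEInfty.out)).differentiableAt (by simp)
  have hX' : HasFDerivAt X ((fderiv ℝ (fderiv ℝ F) (o, o) ∘L .inl ℝ E E).flip (0, X o)) o := by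
    refine HasFDerivAt.congr_of_eventuallyEq ?_ (Filter.mem_of_superset htarget fun u hu ↦ hX hu)
    have h := HasFDerivAt.comp (f := fun u ↦ (u, o)) o hdF.hasFDerivAt (hasFDerivAt_prodMk_left o o)
    exact (h.clm_apply (hasFDerivAt_const (0, X o) o)).congr_fderiv (by ext; simp)
  have hY' : HasFDerivAt Y ((fderiv ℝ (fderiv ℝ F) (o, o) ∘L .inr ℝ E E).flip (Y o, 0)) o := by
    refine HasFDerivAt.congr_of_eventuallyEq ?_ (Filter.mem_of_superset htarget fun u hu ↦ hY hu)
    have h := hdF.hasFDerivAt.comp o (hasFDerivAt_prodMk_right o o)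
    exact (h.clm_apply (hasFDerivAt_const (Y o, 0) o)).congr_fderiv (by ext; simp)
  have hbr : fderiv ℝ Y o (X o) - fderiv ℝ X o (Y o) =
      mpullback 𝓘(ℝ, E) I φ.symm (mlieBracket I (θ.field a) (rightInvariantField I b)) o := by
    rw [mpullback_mlieBracket (n := ∞) (θ.mdifferentiableAt_field _ _)
      ((contMDiff_rightInvariantField I b).mdifferentiable (by simp) _)
      (contMDiffAt_extChartAt_symm ho) hle]
    rw [← mlieBracketWithin_univ, mlieBracketWithin_eq_lieBracketWithin]
    exact (congrFun (lieBracketWithin_univ (V := X) (W := Y)) o).symm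
  rw [hX'.fderiv, hY'.fderiv] at hbr
  have hsymm := (hF1 ho).isSymmSndFDerivAt hle (0, X o) (Y o, 0)
  have h0 : (P o).inverse (mlieBracket I (θ.field a) (rightInvariantField I b) (φ.symm o)) = 0 := by
    refine Eq.trans hbr.symm ?_
    exact sub_eq_zero.2 hsymm
  have h1 : (mlieBracket I (θ.field a) (rightInvariantField I b) (φ.symm o) : E) = 0 :=
    ((hP ho).self_apply_inverse _).symm.trans ((congrArg (P o) h0).trans (map_zero _))
  have h2 (z : N) (hz : z = 1)
      (h : (mlieBracket I (θ.field a) (rightInvariantField I b) z : E) = 0) :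
      (mlieBracket I (θ.field a) (rightInvariantField I b) 1 : E) = 0 := by
    subst hz
    exact h
  exact h2 _ hψo h1

end LieGroup

section BiInvariant

variable {E : Type*} [NormedAddCommGroup E] [NormedSpace ℝ E] [FiniteDimensional ℝ E]
  [CompleteSpace E]
  {H : Type*} [TopologicalSpace H] (I : ModelWithCorners ℝ E H)
  (N : Type*) [TopologicalSpace N] [ChartedSpace H N] [Group N] [LieGroup I ∞ N]

/-- The bracket of the Lie algebra of `N`, as a continuous bilinear map of the model space. -/
def adjointMap : E →L[ℝ] E →L[ℝ] E :=
  LinearMap.toContinuousBilinearMap (LinearMap.mk₂ ℝ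
    (fun a b : E ↦
      (mlieBracket I (mulInvariantVectorField a) (mulInvariantVectorField b) (1 : N) : E))
    (fun a b c ↦ add_lie (L := GroupLieAlgebra I N) (M := GroupLieAlgebra I N) a b c)
    (fun r a b ↦ smul_lie (R := ℝ) (L := GroupLieAlgebra I N) (M := GroupLieAlgebra I N) r a b)
    (fun a b c ↦ lie_add (L := GroupLieAlgebra I N) (M := GroupLieAlgebra I N) a b c)
    (fun r a b ↦ lie_smul (R := ℝ) (L := GroupLieAlgebra I N) (M := GroupLieAlgebra I N) r a b))

lemma adjointMap_swap (a b : E) : adjointMap I N b a = - adjointMap I N a b :=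
  (lie_skew (L := GroupLieAlgebra I N) b a).symm

variable {I N}

lemma coord_mlieBracket_field (a b : E) (x : N) : (leftParallelization I N).coord x
    (mlieBracket I ((leftParallelization I N).field a) ((leftParallelization I N).field b) x) =
      adjointMap I N a b := by
  have h := congrFun (mulInvariantVector_mlieBracket (I := I) (G := N) a b) x
  exact (congrArg ((leftParallelization I N).coord x) h.symm).trans
    ((leftParallelization I N).coord_field (adjointMap I N a b) x)

lemma IsTwoStepNilpotent.adjointMap_adjointMap (hN : IsTwoStepNilpotent (GroupLieAlgebra I N))
    (a b c : E) : adjointMap I N a (adjointMap I N b c) = 0 := by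
  have h (x y z : GroupLieAlgebra I N) : ⁅x, ⁅y, z⁆⁆ = 0 := by
    have h1 : ⁅y, z⁆ ∈
        LieModule.lowerCentralSeries ℝ (GroupLieAlgebra I N) (GroupLieAlgebra I N) 1 := by
      rw [LieModule.lowerCentralSeries_succ]
      exact LieSubmodule.lie_mem_lie (LieSubmodule.mem_top _) (by simp)
    have h2 : ⁅x, ⁅y, z⁆⁆ ∈
        LieModule.lowerCentralSeries ℝ (GroupLieAlgebra I N) (GroupLieAlgebra I N) 2 := by
      rw [LieModule.lowerCentralSeries_succ]
      exact LieSubmodule.lie_mem_lie (LieSubmodule.mem_top _) h1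
    rw [hN.1] at h2
    exact h2
  exact h a b c

variable (I N) in
/-- The connection on `N` with `∇_X Y = ½ [X, Y]` for left-invariant vector fields. -/
def cartanConnection : CovariantDerivative I E (TangentSpace I : N → Type _) :=
  (leftParallelization I N).connection ((2⁻¹ : ℝ) • adjointMap I N)

lemma torsion_cartanConnection : (cartanConnection I N).torsion = 0 := by
  refine Parallelization.torsion_connection _ fun a b x ↦ ?_
  rw [coord_mlieBracket_field, smul_apply, smul_apply, smul_apply, smul_apply, adjointMap_swap I N a b]
  module

/-- The adjoint representation: the derivative at the identity of `g ↦ Ad(g⁻¹) b`. -/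
lemma mvfderiv_coord_rightInvariantField [I.Boundaryless] (a b : E) :
    mvfderiv I (fun g : N ↦ (leftParallelization I N).coord g (rightInvariantField I b g)) 1 a =
      - adjointMap I N a b := by
  set θ := leftParallelization I N with hθ
  have hR : MDiff (T% (rightInvariantField I b : Π x : N, TangentSpace I x)) :=
    (contMDiff_rightInvariantField I b).mdifferentiable (by simp)
  have h := (cartanConnection I N).torsion_eq_zero_iff.1 torsion_cartanConnection
    (θ.mdifferentiableAt_field a 1) (hR 1)
  have h0 := mlieBracket_left_right I (N := N) a b
  rw [← hθ] at h0
  rw [h0] at h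
  have h1 : θ.field a (1 : N) = a := leftParallelization_field_one I a
  have h2 : rightInvariantField I b (1 : N) = b := rightInvariantField_one I b
  rw [cartanConnection, Parallelization.connection_field, Parallelization.connection_apply, ← hθ,
    h1, h2, sub_eq_zero] at h
  have h3 := congrArg (θ.coord 1) h
  rw [ContinuousLinearEquiv.apply_symm_apply, θ.coord_field] at h3
  have h4 (v : E) : θ.coord (1 : N) v = v := leftParallelization_coord_one I v
  rw [h4, h4, smul_apply, smul_apply, smul_apply, smul_apply, adjointMap_swap I N a b] at h3
  rw [eq_sub_of_add_eq h3]
  module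

namespace PseudoRiemannianMetric

variable (Q : PseudoRiemannianMetric I N)

/-- The metric at the identity. -/
def form : E →L[ℝ] E →L[ℝ] ℝ := Q.inner 1

omit [FiniteDimensional ℝ E] [CompleteSpace E] in
lemma form_symm (a b : E) : Q.form a b = Q.form b a := Q.symm 1 a b

omit [FiniteDimensional ℝ E] [CompleteSpace E] in
lemma eq_zero_of_form (a : E) (h : ∀ b, Q.form a b = 0) : a = 0 := Q.nondegenerate 1 a h

variable {Q}

omit [FiniteDimensional ℝ E] [CompleteSpace E] in
lemma inner_eq_of_eq_one {x : N} (hx : x = 1) (u v : E) :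
    Q.inner x (u : TangentSpace I x) (v : TangentSpace I x) = Q.form u v := by
  subst hx
  rfl

variable (hQ : Q.IsBiInvariant)
include hQ

omit [FiniteDimensional ℝ E] [CompleteSpace E] in
lemma IsBiInvariant.inner_eq (x : N) (u v : TangentSpace I x) : Q.inner x u v =
    Q.form ((leftParallelization I N).coord x u) ((leftParallelization I N).coord x v) :=
  (hQ.1 x⁻¹ x u v).symm.trans (inner_eq_of_eq_one (inv_mul_cancel x) _ _)

omit [FiniteDimensional ℝ E] [CompleteSpace E] in
lemma IsBiInvariant.form_coord_rightInvariantField (x : N) (b c : E) :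
    Q.form ((leftParallelization I N).coord x (rightInvariantField I b x))
      ((leftParallelization I N).coord x (rightInvariantField I c x)) = Q.form b c := by
  rw [← hQ.inner_eq]
  have h (z : N) (hz : z = x) (u v : E) : Q.inner x (u : TangentSpace I x) (v : TangentSpace I x) =
      Q.inner z (u : TangentSpace I z) (v : TangentSpace I z) := by
    subst hz
    rfl
  exact (h _ (one_mul x) _ _).trans (hQ.2 x 1 b c)

end PseudoRiemannianMetric

end BiInvariant

section Bilinear

variable {E : Type*} [NormedAddCommGroup E] [NormedSpace ℝ E]

lemma mvfderiv_bilinear {H : Type*} [TopologicalSpace H] {I : ModelWithCorners ℝ E H}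
    {M : Type*} [TopologicalSpace M] [ChartedSpace H M]
    {F : Type*} [NormedAddCommGroup F] [NormedSpace ℝ F] (B : F →L[ℝ] F →L[ℝ] ℝ) {f g : M → F}
    {x : M} (hf : MDiffAt f x) (hg : MDiffAt g x) (v : TangentSpace I x) :
    mvfderiv I (fun y ↦ B (f y) (g y)) x v =
      B (mvfderiv I f x v) (g x) + B (f x) (mvfderiv I g x v) := by
  have h := HasMFDerivAt.comp (f := fun y ↦ (f y, g y)) x
    (B.isBoundedBilinearMap.hasFDerivAt (f x, g x)).hasMFDerivAt
    ⟨hf.continuousAt.prodMk hg.continuousAt,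
      hf.hasMFDerivAt_mvfderiv.2.prodMk hg.hasMFDerivAt_mvfderiv.2⟩
  rw [add_comm]
  exact congrArg (fun T : E →L[ℝ] ℝ ↦ T v) h.mvfderiv_eq

/-- A trilinear expression that is symmetric in the first two arguments and skew in the last two
vanishes. -/
lemma eq_zero_of_symm_of_skew {B : E →L[ℝ] E →L[ℝ] ℝ} (hB : ∀ a b, B a b = B b a)
    (hB' : ∀ a, (∀ b, B a b = 0) → a = 0) {S : E → E → E} (h1 : ∀ a b, S a b = S b a)
    (h2 : ∀ a b c, B (S a b) c + B b (S a c) = 0) (a b : E) : S a b = 0 := by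
  refine hB' _ fun c ↦ ?_
  have e1 := h2 a b c
  have e2 := h2 c b a
  have e3 := h2 b c a
  rw [hB b] at e1 e2
  rw [hB c] at e3
  rw [h1 c a, h1 c b] at e2
  rw [h1 b a] at e3
  linarith

end Bilinear

section BiInvariant

variable {E : Type*} [NormedAddCommGroup E] [NormedSpace ℝ E] [FiniteDimensional ℝ E]
  [CompleteSpace E]
  {H : Type*} [TopologicalSpace H] {I : ModelWithCorners ℝ E H}
  {N : Type*} [TopologicalSpace N] [ChartedSpace H N] [Group N] [LieGroup I ∞ N]
  {Q : PseudoRiemannianMetric I N}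

/-- The adjoint representation is skew for the form at the identity. -/
lemma PseudoRiemannianMetric.IsBiInvariant.form_adjointMap [I.Boundaryless] (hQ : Q.IsBiInvariant)
    (a b c : E) : Q.form (adjointMap I N a b) c + Q.form b (adjointMap I N a c) = 0 := by
  have hd (b : E) : MDiffAt
      (fun g : N ↦ (leftParallelization I N).coord g (rightInvariantField I b g)) 1 :=
    Parallelization.mdifferentiableAt_coord_comp
      ((contMDiff_rightInvariantField I b).mdifferentiable (by simp) 1)
  have h1 (b : E) :
      (leftParallelization I N).coord 1 (rightInvariantField I b (1 : N)) = b :=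
    (leftParallelization_coord_one I _).trans (rightInvariantField_one I b)
  have h := mvfderiv_bilinear Q.form (hd b) (hd c) a
  simp only [hQ.form_coord_rightInvariantField] at h
  rw [mvfderiv_coord_rightInvariantField, mvfderiv_coord_rightInvariantField, h1, h1,
    mvfderiv_const] at h
  have h' : (0 : ℝ) = Q.form (- adjointMap I N a b) c + Q.form b (- adjointMap I N a c) := h
  rw [map_neg, map_neg, neg_apply] at h'
  linarith

lemma isLeviCivita_cartanConnection [I.Boundaryless] (hQ : Q.IsBiInvariant) :
    IsLeviCivita Q (cartanConnection I N) where
  smooth := Parallelization.contMDiffCovariantDerivative_connection _ _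
  torsion_eq_zero := torsion_cartanConnection
  compatible Y Z x hY hZ v := by
    set θ := leftParallelization I N with hθ
    simp only [hQ.inner_eq]
    rw [← hθ, mvfderiv_bilinear Q.form (Parallelization.mdifferentiableAt_coord_comp hY)
      (Parallelization.mdifferentiableAt_coord_comp hZ), cartanConnection,
      Parallelization.connection_apply, Parallelization.connection_apply, ← hθ,
      ContinuousLinearEquiv.apply_symm_apply, ContinuousLinearEquiv.apply_symm_apply]
    have h := hQ.form_adjointMap (θ.coord x v) (θ.coord x (Y x)) (θ.coord x (Z x))
    simp only [smul_apply, map_add, map_smul, add_apply, smul_eq_mul]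
    linarith

/-- A Levi-Civita connection of a bi-invariant metric is `½ [X, Y]` on left-invariant fields. -/
lemma IsLeviCivita.cov_field [I.Boundaryless] (hQ : Q.IsBiInvariant)
    {cov : CovariantDerivative I E (TangentSpace I : N → Type _)} (h : IsLeviCivita Q cov)
    (b : E) (x : N) (v : TangentSpace I x) : cov ((leftParallelization I N).field b) x v =
      (leftParallelization I N).field
        ((2⁻¹ : ℝ) • adjointMap I N ((leftParallelization I N).coord x v) b) x := by
  set θ := leftParallelization I N with hθ
  have key (a b : E) : θ.coord x (cov (θ.field b) x (θ.field a x)) -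
      (2⁻¹ : ℝ) • adjointMap I N a b = 0 := by
    refine eq_zero_of_symm_of_skew Q.form_symm Q.eq_zero_of_form
      (S := fun a b ↦ θ.coord x (cov (θ.field b) x (θ.field a x)) - (2⁻¹ : ℝ) • adjointMap I N a b)
      (fun a b ↦ ?_) (fun a b c ↦ ?_) a b
    · have ht := cov.torsion_eq_zero_iff.1 h.torsion_eq_zero (θ.mdifferentiableAt_field a x)
        (θ.mdifferentiableAt_field b x)
      have ht' := congrArg (θ.coord x) ht
      rw [map_sub, coord_mlieBracket_field] at ht'
      rw [sub_eq_iff_eq_add.1 ht', adjointMap_swap I N a b]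
      module
    · have hc := h.compatible _ _ x (θ.mdifferentiableAt_field b x)
        (θ.mdifferentiableAt_field c x) (θ.field a x)
      simp only [hQ.inner_eq, ← hθ, θ.coord_field, mvfderiv_const] at hc
      have hc' : (0 : ℝ) = _ := hc
      have hs := hQ.form_adjointMap a b c
      simp only [map_sub, map_smul, sub_apply, smul_apply, smul_eq_mul]
      linarith
  have h1 := sub_eq_zero.1 (key (θ.coord x v) b)
  rw [θ.field_coord] at h1
  rw [← h1, θ.field_coord]

end BiInvariant

section TwoStep

variable {E : Type*} [NormedAddCommGroup E] [NormedSpace ℝ E] [FiniteDimensional ℝ E]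
  [CompleteSpace E]
  {H : Type*} [TopologicalSpace H] {I : ModelWithCorners ℝ E H}
  {M : Type*} [TopologicalSpace M] [ChartedSpace H M] [IsManifold I ∞ M]

/-- The parallelization `(1 + Φ) ∘ θ`, for a square-zero field of endomorphisms `Φ`. -/
def Parallelization.twist (θ : Parallelization I M) {Φ : M → E →L[ℝ] E} (hΦ : CMDiff ∞ Φ)
    (hsq : ∀ x a, Φ x (Φ x a) = 0) : Parallelization I M where
  coord x := (θ.coord x).trans (ContinuousLinearEquiv.equivOfInverse
    (ContinuousLinearMap.id ℝ E + Φ x) (ContinuousLinearMap.id ℝ E - Φ x)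
    (fun a ↦ by simp [hsq]) (fun a ↦ by simp [hsq]))
  contMDiff_coord := by
    have h : ContMDiff I.tangent 𝓘(ℝ, E →L[ℝ] E) ∞ (fun W : TangentBundle I M ↦ Φ W.proj) :=
      hΦ.comp (contMDiff_proj _)
    exact θ.contMDiff_coord.add (h.clm_apply θ.contMDiff_coord)
  contMDiff_symm a x := by
    refine Parallelization.contMDiffAt_symm_comp (f := fun x ↦ a - Φ x a) le_rfl ?_
    exact contMDiffAt_const.sub ((hΦ x).clm_apply contMDiffAt_const)

omit [CompleteSpace E] in
lemma Parallelization.twist_field (θ : Parallelization I M) {Φ : M → E →L[ℝ] E} (hΦ : CMDiff ∞ Φ)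
    (hsq : ∀ x a, Φ x (Φ x a) = 0) (a : E) :
    (θ.twist hΦ hsq).field a = fun x ↦ (θ.coord x).symm (a - Φ x a) := rfl

end TwoStep

section SimplyConnected

variable {E : Type*} [NormedAddCommGroup E] [NormedSpace ℝ E] [FiniteDimensional ℝ E]
  [CompleteSpace E]
  {H : Type*} [TopologicalSpace H] {I : ModelWithCorners ℝ E H} [I.Boundaryless]
  {N : Type*} [TopologicalSpace N] [ChartedSpace H N] [Group N] [LieGroup I ∞ N]
  [SimplyConnectedSpace N]

/-- On a simply connected 2-step nilpotent group, the adjoint one-form is exact with a primitive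
whose values annihilate brackets. -/
lemma IsTwoStepNilpotent.exists_primitive (hN : IsTwoStepNilpotent (GroupLieAlgebra I N)) :
    ∃ Φ : N → E →L[ℝ] E, CMDiff ∞ Φ ∧ (∀ x, ∃ a, Φ x = adjointMap I N a) ∧
      ∀ x, HasMFDerivAt I 𝓘(ℝ, E →L[ℝ] E) Φ x (adjointMap I N ∘L
        ((leftParallelization I N).coord x : TangentSpace I x →L[ℝ] E)) := by
  let V : Submodule ℝ (E →L[ℝ] E) := (adjointMap I N : E →L[ℝ] E →L[ℝ] E).toLinearMap.range
  let L : E →L[ℝ] V := (adjointMap I N : E →L[ℝ] E →L[ℝ] E).codRestrict V fun a ↦ ⟨a, rfl⟩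
  have : CompleteSpace V := FiniteDimensional.complete ℝ V
  have hL (a b : E) : L (adjointMap I N a b) = 0 := by
    have h : adjointMap I N (adjointMap I N a b) = 0 := by
      ext c
      rw [adjointMap_swap, hN.adjointMap_adjointMap, neg_zero]
      rfl
    exact Subtype.ext h
  obtain ⟨f, hf, hf'⟩ := Parallelization.exists_primitive (V := V) (θ := leftParallelization I N) L
    fun a b x ↦ by rw [coord_mlieBracket_field, hL]
  refine ⟨fun x ↦ f x, fun x ↦ (hf x).continuousLinearMap_comp V.subtypeL,
    fun x ↦ ?_, fun x ↦ (hf' x).continuousLinearMap_comp V.subtypeL⟩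
  obtain ⟨a, ha⟩ := (f x).2
  exact ⟨a, ha.symm⟩

/-- The Levi-Civita connection of a bi-invariant metric on a simply connected 2-step nilpotent Lie
group has a global parallel frame. -/
theorem IsLeviCivita.exists_isParallelFor (hN : IsTwoStepNilpotent (GroupLieAlgebra I N))
    {Q : PseudoRiemannianMetric I N} (hQ : Q.IsBiInvariant)
    {cov : CovariantDerivative I E (TangentSpace I : N → Type _)} (h : IsLeviCivita Q cov) :
    ∃ θ : Parallelization I N, θ.IsParallelFor cov := by
  obtain ⟨Φ, hΦ, hΦa, hΦ'⟩ := hN.exists_primitive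
  set θ := leftParallelization I N with hθ
  have hmul (a b : E) (x : N) : adjointMap I N a (Φ x b) = 0 := by
    obtain ⟨c, hc⟩ := hΦa x
    rw [hc, hN.adjointMap_adjointMap]
  let Ψ : N → E →L[ℝ] E := fun x ↦ (2⁻¹ : ℝ) • Φ x
  have hΨ : CMDiff ∞ Ψ := fun x ↦
    (hΦ x).continuousLinearMap_comp ((2⁻¹ : ℝ) • ContinuousLinearMap.id ℝ (E →L[ℝ] E))
  have hsq (x : N) (a : E) : Ψ x (Ψ x a) = 0 := by
    obtain ⟨c, hc⟩ := hΦa x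
    simp only [Ψ, smul_apply, map_smul]
    rw [show Φ x (Φ x a) = 0 by nth_rewrite 1 [hc]; exact hmul c a x]
    simp
  refine ⟨θ.twist hΨ hsq, fun a x ↦ ?_⟩
  rw [θ.twist_field]
  ext v
  have hd : HasMFDerivAt I 𝓘(ℝ, E) (fun y ↦ a - Ψ y a) x
      (-((2⁻¹ : ℝ) • (adjointMap I N).flip a) ∘L (θ.coord x : TangentSpace I x →L[ℝ] E)) := by
    have h1 := (hΦ' x).continuousLinearMap_comp
      ((2⁻¹ : ℝ) • ContinuousLinearMap.apply ℝ E a)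
    have h2 := (hasMFDerivAt_const (I := I) (I' := 𝓘(ℝ, E)) a x).sub h1
    refine h2.congr_deriv ?_
    ext v
    exact zero_sub (G := E) _
  rw [Parallelization.cov_symm_comp cov hd.mdifferentiableAt, hd.mvfderiv_eq, h.cov_field hQ]
  rw [← hθ, Parallelization.field, ← map_add]
  have : (-((2⁻¹ : ℝ) • (adjointMap I N).flip a) ∘L (θ.coord x : TangentSpace I x →L[ℝ] E)) v +
      (2⁻¹ : ℝ) • adjointMap I N (θ.coord x v) (a - Ψ x a) = 0 := by
    have h0 : adjointMap I N (θ.coord x v) (Ψ x a) = 0 := by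
      simp only [Ψ, smul_apply, map_smul, hmul, smul_zero]
    rw [map_sub, h0, sub_zero]
    exact neg_add_cancel _
  rw [this]
  exact map_zero _

end SimplyConnected

theorem mainTheorem10
    {E : Type*} [NormedAddCommGroup E] [NormedSpace ℝ E] [FiniteDimensional ℝ E] [CompleteSpace E]
    {H : Type*} [TopologicalSpace H] (I : ModelWithCorners ℝ E H) [I.Boundaryless]
    (N : Type*) [TopologicalSpace N] [ChartedSpace H N] [Group N] [LieGroup I ∞ N]
    [SimplyConnectedSpace N]
    (hN : IsTwoStepNilpotent (GroupLieAlgebra I N))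
    (Q : PseudoRiemannianMetric I N) (hQ : Q.IsBiInvariant) :
    (∃ cov : CovariantDerivative I E (TangentSpace I : N → Type _), IsLeviCivita Q cov) ∧
    ∀ cov : CovariantDerivative I E (TangentSpace I : N → Type _), IsLeviCivita Q cov →
      IsFlat cov ∧
      ∀ p : N, holonomyGroup cov p = ⊥ ∧
        ∀ γ : ℝ → N, IsPiecewiseC1 I γ → γ 0 = p → γ 1 = p →
          IsParallelTransport cov p γ (LinearEquiv.refl ℝ (TangentSpace I p)) := by
  refine ⟨⟨cartanConnection I N, isLeviCivita_cartanConnection hQ⟩, fun cov hcov ↦ ?_⟩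
  obtain ⟨θ, hθ⟩ := hcov.exists_isParallelFor hN hQ
  exact ⟨hθ.isFlat, fun p ↦ ⟨hθ.holonomyGroup_eq_bot p, fun γ hγ h0 h1 ↦
    hθ.isParallelTransport_refl hγ h0 h1⟩⟩

end
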